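/- Let $d,n\ge 1$ be integers and let $\mathbb B_d$ be the open unit ball of $\mathbb C^d$. Let $H^2_d$ be the Drury–Arveson space, the reproducing kernel Hilbert space on $\mathbb B_d$ with kernel $1/(1-\langle z,w\rangle)$, and let $\mathcal M_d\subset B(H^2_d)$ be its multiplier algebra, each multiplier $f$ being identified with the multiplication operator $M_f$. Let $$\mathbb P_{d,n}=\{P\in B(H^2_d) : P=P^2=P^*,\ P M_f^*P=M_f^*P \text{ for all } f\in\mathcal M_d,\ \dim PH^2_d=n\}$$ with the norm topology. A *Banach bundle* over a space $X$ is a continuous open surjection $\pi$ from a Hausdorff space onto $X$ whose fibres are complex Banach spaces, such that the norm, the addition (of pairs in the same fibre) and the multiplication by each scalar are continuous on the total space, and such that $b_i\to 0_x$ whenever $\|b_i\|\to0$ and $\pi(b_i)\to x$. It is a *Banach algebra bundle* if the fibres are Banach algebras and multiplication is continuous. A *Hilbert bundle of rank $n$* is a Banach bundle whose fibres are Hilbert spaces and which is locally trivial with model fibre $\mathbb C^n$, through fibrewise unitary trivializations. Then the following hold. 1. The tautological bundle $\mathcal E_{d,n}=\bigsqcup_{P\in\mathbb P_{d,n}} PH^2_d$,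 topologized as a subspace of $\mathbb P_{d,n}\times H^2_d$, is a Hilbert bundle of rank $n$ over $\mathbb P_{d,n}$. 2. On $\mathfrak M_{d,n}=\bigsqcup_{P\in\mathbb P_{d,n}} P\mathcal M_d|_{PH^2_d}$, where the fibres carry the operator norm of $B(PH^2_d)$, there is exactly one topology that makes it a Banach bundle over $\mathbb P_{d,n}$ for which all sections $\gamma_f(P)=PM_f|_{PH^2_d}$, $f\in\mathcal M_d$, are continuous. With this topology $\mathfrak M_{d,n}$ is a Banach algebra bundle. 3. For every $m\in\mathbb N$ the same holds for $M_m(\mathfrak M_{d,n})=\bigsqcup_{P} (I_m\otimes P)M_m(\mathcal M_d)|_{\mathbb C^m\otimes PH^2_d}$, with the operator norm of $B(\mathbb C^m\otimes PH^2_d)$ on the fibres and with the sections given by the elements of $M_m(\mathcal M_d)$. The continuous sections of $M_m(\mathfrak M_{d,n})$ are exactly the $m\times m$ matrices of continuous sections of $\mathfrak M_{d,n}$. 4. Let $\Gamma_b$ be the set of all bounded continuous sections of $\mathfrak M_{d,n}$ with the norm $\|x\|=\sup_P\|x(P)\|$. It is an algebra under the pointwise operations, it contains every $\gamma_f$, and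 $M_m(\Gamma_b)$ is the space of bounded continuous sections of $M_m(\mathfrak M_{d,n})$. With the supremum norms on the spaces $M_m(\Gamma_b)$, $m\in\mathbb N$, the algebra $\Gamma_b$ is an operator algebra: it is complete, it satisfies Ruan's axioms $\|X\oplus Y\|=\max(\|X\|,\|Y\|)$ and $\|\alpha X\beta\|\le\|\alpha\|\|X\|\|\beta\|$ (for scalar matrices $\alpha,\beta$), the matrix multiplication of $M_m(\Gamma_b)$ is contractive for every $m$, and its unit has norm $1$; and it is completely isometrically isomorphic, as a unital algebra, to a norm-closed algebra of bounded operators on a Hilbert space. -/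

import Mathlib

/-! ## The Drury–Arveson space -/

open scoped ComplexOrder in
/-- Entrywise powers of Gram matrices are positive semidefinite. -/
theorem inner_pow_posSemidef {𝕜 ι E : Type*} [RCLike 𝕜] [NormedAddCommGroup E]
    [InnerProductSpace 𝕜 E] [Finite ι] (v : ι → E) (m : ℕ) :
    (Matrix.of fun i j => (inner 𝕜 (v i) (v j) : 𝕜) ^ m).PosSemidef := by
  have := Fintype.ofFinite ι
  induction m with
  | zero =>
    convert Matrix.posSemidef_vecMulVec_self_star (R := 𝕜) (fun _ : ι => (1 : 𝕜)) using 1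
    ext i j
    simp [Matrix.vecMulVec]
  | succ m ih =>
    convert ih.hadamard (Matrix.posSemidef_gram 𝕜 v) using 1
    ext i j
    simp [pow_succ]

/-- The open unit ball of `ℂ^d`. -/
abbrev unitBall (d : ℕ) : Set (EuclideanSpace ℂ (Fin d)) :=
  Metric.ball (0 : EuclideanSpace ℂ (Fin d)) 1

/-- The kernel `k(z, w) = 1 / (1 - ⟨z, w⟩)` on the unit ball of `ℂ^d`, where `⟨z, w⟩` is linear
in `z` (so it is `inner ℂ w z` in Mathlib's convention), seen as an operator on `ℂ`. -/
noncomputable def druryArvesonKernel (d : ℕ) :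
    Matrix (unitBall d) (unitBall d) (ℂ →L[ℂ] ℂ) :=
  Matrix.of fun z w =>
    (1 - inner ℂ (w : EuclideanSpace ℂ (Fin d)) (z : EuclideanSpace ℂ (Fin d)))⁻¹ •
      ContinuousLinearMap.id ℂ ℂ

open scoped ComplexOrder in
theorem druryArvesonKernel_posSemidef (d : ℕ) : (druryArvesonKernel d).PosSemidef := by
  have key := (RKHS.posSemidef_tfae (K := druryArvesonKernel d)).out 0 2
  refine key.mpr ⟨?_, fun x => ?_⟩
  · ext i j
    have h : star (ContinuousLinearMap.id ℂ ℂ) = ContinuousLinearMap.id ℂ ℂ :=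
      star_one (ℂ →L[ℂ] ℂ)
    simp [druryArvesonKernel, Matrix.conjTranspose_apply, star_smul, h]
  · have hs : HasSum (fun m : ℕ => ∑ i ∈ x.support, ∑ j ∈ x.support,
        star (x i) * (inner ℂ (j : EuclideanSpace ℂ (Fin d))
          (i : EuclideanSpace ℂ (Fin d)) : ℂ) ^ m * x j)
        (x.sum fun i a => x.sum fun j b => inner ℂ (druryArvesonKernel d j i a) b) := by
      refine hasSum_sum fun i _ => hasSum_sum fun j _ => ?_
      have h1 : ‖(inner ℂ (j : EuclideanSpace ℂ (Fin d))
          (i : EuclideanSpace ℂ (Fin d)) : ℂ)‖ < 1 := by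
        have hi := mem_ball_zero_iff.mp i.2
        have hj := mem_ball_zero_iff.mp j.2
        calc _ ≤ ‖(j : EuclideanSpace ℂ (Fin d))‖ * ‖(i : EuclideanSpace ℂ (Fin d))‖ :=
              norm_inner_le_norm _ _
          _ < 1 := by
            nlinarith [norm_nonneg (j : EuclideanSpace ℂ (Fin d)),
              norm_nonneg (i : EuclideanSpace ℂ (Fin d))]
      have h2 : inner ℂ (druryArvesonKernel d j i (x i)) (x j) = star (x i) *
          (1 - inner ℂ (j : EuclideanSpace ℂ (Fin d)) (i : EuclideanSpace ℂ (Fin d)))⁻¹ *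
            x j := by
        simp [druryArvesonKernel]
        ring
      simp only [h2]
      exact ((hasSum_geometric_of_norm_lt_one h1).mul_left (star (x i))).mul_right (x j)
    refine (Complex.hasSum_re hs).nonneg fun m => ?_
    have hp := (inner_pow_posSemidef (𝕜 := ℂ) (fun i : x.support =>
      (i.1 : EuclideanSpace ℂ (Fin d))) m).transpose.dotProduct_mulVec_nonneg (fun i => x i)
    have h3 := (RCLike.nonneg_iff.mp hp).1
    have e : (∑ i ∈ x.support, ∑ j ∈ x.support,
        star (x i) * (inner ℂ (j : EuclideanSpace ℂ (Fin d))
          (i : EuclideanSpace ℂ (Fin d)) : ℂ) ^ m * x j) =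
        (star fun i : x.support => x ↑i) ⬝ᵥ (Matrix.of fun i j : x.support =>
          (inner ℂ (i.1 : EuclideanSpace ℂ (Fin d))
            (j.1 : EuclideanSpace ℂ (Fin d)) : ℂ) ^ m).transpose.mulVec fun i => x ↑i := by
      simp [dotProduct, Matrix.mulVec, Finset.mul_sum, ← Finset.sum_coe_sort x.support, mul_assoc]
    rw [e]
    exact h3

instance (d : ℕ) : Fact (druryArvesonKernel d).PosSemidef := ⟨druryArvesonKernel_posSemidef d⟩

/-- The Drury–Arveson space `H²_d`: the reproducing kernel Hilbert space of functions on the unit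
ball of `ℂ^d` with kernel `1 / (1 - ⟨z, w⟩)`. -/
def DruryArveson (d : ℕ) : Type := RKHS.OfKernel (druryArvesonKernel d)

namespace DruryArveson

noncomputable instance (d : ℕ) : NormedAddCommGroup (DruryArveson d) :=
  inferInstanceAs (NormedAddCommGroup (RKHS.OfKernel (druryArvesonKernel d)))

noncomputable instance (d : ℕ) : InnerProductSpace ℂ (DruryArveson d) :=
  inferInstanceAs (InnerProductSpace ℂ (RKHS.OfKernel (druryArvesonKernel d)))

instance (d : ℕ) : CompleteSpace (DruryArveson d) :=
  inferInstanceAs (CompleteSpace (RKHS.OfKernel (druryArvesonKernel d)))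

noncomputable instance (d : ℕ) : RKHS ℂ (DruryArveson d) (unitBall d) ℂ :=
  inferInstanceAs (RKHS ℂ (RKHS.OfKernel (druryArvesonKernel d)) (unitBall d) ℂ)

theorem kernel_eq (d : ℕ) : RKHS.kernel (DruryArveson d) = druryArvesonKernel d :=
  RKHS.OfKernel.kernel_ofKernel (K := druryArvesonKernel d)

end DruryArveson

/-- The multiplier algebra `𝓜_d`, as the algebra of all bounded multiplication operators
`M_φ : h ↦ φ h` on `H²_d`; its norm is the multiplier norm. -/
def multiplierAlgebra (d : ℕ) : Subalgebra ℂ (DruryArveson d →L[ℂ] DruryArveson d) where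
  carrier := {T | ∃ φ : unitBall d → ℂ, ∀ (h : DruryArveson d) (z : unitBall d),
    (T h) z = φ z * h z}
  mul_mem' := by
    rintro S T ⟨φ, hφ⟩ ⟨ψ, hψ⟩
    exact ⟨fun z => φ z * ψ z, fun h z => by
      change (S (T h)) z = _
      rw [hφ, hψ, mul_assoc]⟩
  add_mem' := by
    rintro S T ⟨φ, hφ⟩ ⟨ψ, hψ⟩
    exact ⟨fun z => φ z + ψ z, fun h z => by
      change (S h + T h) z = _
      rw [RKHS.coe_add, Pi.add_apply, hφ, hψ, add_mul]⟩
  algebraMap_mem' := fun c => ⟨fun _ => c, fun h z => by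
    rw [ContinuousLinearMap.algebraMap_apply, RKHS.coe_smul, Pi.smul_apply, smul_eq_mul]⟩

/-! ## The Grassmannian of multiplier-coinvariant subspaces -/

/-- `ℙ_{d,n}`: the orthogonal projections of `H²_d` onto `n`-dimensional subspaces that are
invariant under the adjoints of all multiplication operators. As a subtype of the bounded
operators it carries the norm topology. -/
def coinvariantGrassmannian (d n : ℕ) : Set (DruryArveson d →L[ℂ] DruryArveson d) :=
  {P | P * P = P ∧ ContinuousLinearMap.adjoint P = P ∧
    (∀ T ∈ multiplierAlgebra d,
      P * ContinuousLinearMap.adjoint T * P = ContinuousLinearMap.adjoint T * P) ∧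
    Module.rank ℂ (LinearMap.range (P : DruryArveson d →ₗ[ℂ] DruryArveson d)) = n}

/-- The fibre `P H²_d` of the tautological bundle `𝓔_{d,n}` at `P`. -/
abbrev TautologicalFibre {d n : ℕ} (P : coinvariantGrassmannian d n) : Type :=
  LinearMap.range (P.1 : DruryArveson d →ₗ[ℂ] DruryArveson d)

/-- The compression `P T|_{P H²_d}` of an operator `T` on `H²_d`. -/
noncomputable def compression {d n : ℕ} (P : coinvariantGrassmannian d n)
    (T : DruryArveson d →L[ℂ] DruryArveson d) : TautologicalFibre P →L[ℂ] TautologicalFibre P :=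
  (P.1.codRestrict (LinearMap.range (P.1 : DruryArveson d →ₗ[ℂ] DruryArveson d))
    fun h => ⟨h, rfl⟩) ∘L T ∘L (LinearMap.range (P.1 : DruryArveson d →ₗ[ℂ] DruryArveson d)).subtypeL

theorem coe_compression {d n : ℕ} (P : coinvariantGrassmannian d n)
    (T : DruryArveson d →L[ℂ] DruryArveson d) (v : TautologicalFibre P) :
    ((compression P T v : TautologicalFibre P) : DruryArveson d) = P.1 (T v) := rfl

/-- An element of `P H²_d` is fixed by `P`. -/
theorem proj_apply_fibre {d n : ℕ} (P : coinvariantGrassmannian d n) (v : TautologicalFibre P) :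
    P.1 (v : DruryArveson d) = v := by
  obtain ⟨_, w, rfl⟩ := v
  exact congrArg (fun S : DruryArveson d →L[ℂ] DruryArveson d => S w) P.2.1

/-- Coinvariance: `P T P = P T` for every multiplication operator `T`. -/
theorem proj_mul_proj {d n : ℕ} (P : coinvariantGrassmannian d n)
    {T : DruryArveson d →L[ℂ] DruryArveson d} (hT : T ∈ multiplierAlgebra d) :
    P.1 * T * P.1 = P.1 * T := by
  have hsa : star P.1 = P.1 := P.2.2.1
  have h : P.1 * star T * P.1 = star T * P.1 := P.2.2.2.1 T hT
  have h' := congrArg star h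
  simpa [hsa, mul_assoc] using h'

/-- Compression to `P H²_d` as a unital homomorphism on the multiplier algebra. -/
noncomputable def compressionHom {d n : ℕ} (P : coinvariantGrassmannian d n) :
    multiplierAlgebra d →ₐ[ℂ] (TautologicalFibre P →L[ℂ] TautologicalFibre P) where
  toFun T := compression P T
  map_one' := by
    refine ContinuousLinearMap.ext fun v => Subtype.ext ?_
    exact proj_apply_fibre P v
  map_mul' S T := by
    refine ContinuousLinearMap.ext fun v => Subtype.ext ?_
    have h := congrArg (fun R : DruryArveson d →L[ℂ] DruryArveson d => R (T.1 v))
      (proj_mul_proj P S.2)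
    exact h.symm
  map_zero' := by
    refine ContinuousLinearMap.ext fun v => Subtype.ext ?_
    exact map_zero P.1
  map_add' S T := by
    refine ContinuousLinearMap.ext fun v => Subtype.ext ?_
    exact map_add P.1 _ _
  commutes' c := by
    refine ContinuousLinearMap.ext fun v => Subtype.ext ?_
    exact (map_smul P.1 c (v : DruryArveson d)).trans
      (congrArg (c • ·) (proj_apply_fibre P v))

/-- The fibre `P 𝓜_d|_{P H²_d}` of `𝔐_{d,n}` at `P`, with the norm of operators on `P H²_d`. -/
def MultiplierFibre {d n : ℕ} (P : coinvariantGrassmannian d n) : Type :=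
  (compressionHom P).range

noncomputable instance {d n : ℕ} (P : coinvariantGrassmannian d n) :
    NormedRing (MultiplierFibre P) :=
  inferInstanceAs (NormedRing (compressionHom P).range)

noncomputable instance {d n : ℕ} (P : coinvariantGrassmannian d n) :
    NormedAlgebra ℂ (MultiplierFibre P) :=
  inferInstanceAs (NormedAlgebra ℂ (compressionHom P).range)

/-- The operator on `V^m = ℂ^m ⊗ V` (a Hilbert space) given by an `m × m` matrix of operators on
the Hilbert space `V`. -/
noncomputable def matrixOperator (m : ℕ) (V : Type*) [NormedAddCommGroup V]
    [InnerProductSpace ℂ V] :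
    Matrix (Fin m) (Fin m) (V →L[ℂ] V) →ₐ[ℂ]
      (PiLp 2 (fun _ : Fin m => V) →L[ℂ] PiLp 2 (fun _ : Fin m => V)) where
  toFun A := ((PiLp.continuousLinearEquiv 2 ℂ (fun _ : Fin m => V)).symm :
      (Fin m → V) →L[ℂ] PiLp 2 (fun _ : Fin m => V)) ∘L
    ContinuousLinearMap.pi fun i => ∑ j, A i j ∘L PiLp.proj 2 (fun _ : Fin m => V) j
  map_one' := by
    refine ContinuousLinearMap.ext fun x => PiLp.ext fun i => ?_
    have h : ∀ j, ((1 : Matrix (Fin m) (Fin m) (V →L[ℂ] V)) i j) (x j) =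
        if i = j then x j else 0 := by
      intro j
      by_cases h : i = j <;> simp [Matrix.one_apply, h]
    simp [h]
  map_mul' A B := by
    refine ContinuousLinearMap.ext fun x => PiLp.ext fun i => ?_
    have h : ∀ a, ((A * B) i a) (x a) = ∑ b, A i b (B b a (x a)) := by
      intro a
      simp [Matrix.mul_apply]
    have h' : ∑ a, ((A * B) i a) (x a) = ∑ b, A i b (∑ a, B b a (x a)) := by
      simp only [h, map_sum]
      exact Finset.sum_comm
    simpa using h'
  map_zero' := by
    ext x i
    simp
  map_add' A B := by
    ext x i
    simp [Finset.sum_add_distrib]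
  commutes' c := by
    refine ContinuousLinearMap.ext fun x => PiLp.ext fun i => ?_
    have h : ∀ j, (algebraMap ℂ (Matrix (Fin m) (Fin m) (V →L[ℂ] V)) c i j) (x j) =
        if i = j then c • x j else 0 := by
      intro j
      by_cases h : i = j <;> simp [Matrix.algebraMap_matrix_apply, h]
    simp [h]

/-- The fibre `(I_m ⊗ P) M_m(𝓜_d)|_{ℂ^m ⊗ P H²_d}` of `M_m(𝔐_{d,n})` at `P`, with the norm of
operators on `ℂ^m ⊗ P H²_d = (P H²_d)^m`. -/
def AmplifiedFibre (m : ℕ) {d n : ℕ} (P : coinvariantGrassmannian d n) : Type :=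
  ((matrixOperator m (TautologicalFibre P)).comp (compressionHom P).mapMatrix).range

noncomputable instance (m : ℕ) {d n : ℕ} (P : coinvariantGrassmannian d n) :
    NormedRing (AmplifiedFibre m P) :=
  inferInstanceAs (NormedRing
    ((matrixOperator m (TautologicalFibre P)).comp (compressionHom P).mapMatrix).range)

noncomputable instance (m : ℕ) {d n : ℕ} (P : coinvariantGrassmannian d n) :
    NormedAlgebra ℂ (AmplifiedFibre m P) :=
  inferInstanceAs (NormedAlgebra ℂ
    ((matrixOperator m (TautologicalFibre P)).comp (compressionHom P).mapMatrix).range)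

/-! ## Banach bundles, Banach algebra bundles and Hilbert bundles

For `E : X → Type*`, the total space is `Bundle.TotalSpace F E`, whose parameter `F` is only a
label (it is the model fibre for locally trivial bundles, and `Unit` otherwise). -/

open Bundle in
/-- A Banach bundle: a continuous open surjection from a Hausdorff space (surjectivity is automatic
here, each fibre has a zero) whose fibres are complex Banach spaces, with continuous norm and linear
operations, such that `b_i → 0_x` whenever `‖b_i‖ → 0` and `π(b_i) → x`. -/
structure IsBanachBundle {X : Type*} [TopologicalSpace X] (F : Type*) (E : X → Type*)
    [∀ x, NormedAddCommGroup (E x)] [∀ x, NormedSpace ℂ (E x)]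
    [TopologicalSpace (TotalSpace F E)] : Prop where
  t2Space : T2Space (TotalSpace F E)
  completeSpace : ∀ x, CompleteSpace (E x)
  continuous_proj : Continuous (π F E)
  isOpenMap_proj : IsOpenMap (π F E)
  continuous_norm : Continuous fun b : TotalSpace F E => ‖b.snd‖
  continuous_add : Continuous fun b : TotalSpace (F × F) (E ×ᵇ E) =>
    (⟨b.proj, b.snd.1 + b.snd.2⟩ : TotalSpace F E)
  continuous_smul : ∀ c : ℂ, Continuous fun b : TotalSpace F E =>
    (⟨b.proj, c • b.snd⟩ : TotalSpace F E)
  tendsto_zero : ∀ x : X,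
    Filter.comap (fun b : TotalSpace F E => ‖b.snd‖) (nhds 0) ⊓ Filter.comap (π F E) (nhds x) ≤
      nhds (⟨x, 0⟩ : TotalSpace F E)

open Bundle in
/-- A Banach algebra bundle: a Banach bundle whose fibres are Banach algebras, with continuous
multiplication. -/
structure IsBanachAlgebraBundle {X : Type*} [TopologicalSpace X] (F : Type*) (E : X → Type*)
    [∀ x, NormedRing (E x)] [∀ x, NormedAlgebra ℂ (E x)]
    [TopologicalSpace (TotalSpace F E)] : Prop extends IsBanachBundle F E where
  continuous_mul : Continuous fun b : TotalSpace (F × F) (E ×ᵇ E) =>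
    (⟨b.proj, b.snd.1 * b.snd.2⟩ : TotalSpace F E)

open Bundle in
/-- A locally trivial Hilbert bundle with model fibre the Hilbert space `F`: a Banach bundle with
Hilbert space fibres which near every point of the base admits a trivialization that is a linear
isometry from each fibre onto `F`. -/
structure IsHilbertBundle {X : Type*} [TopologicalSpace X] (F : Type*) [NormedAddCommGroup F]
    [InnerProductSpace ℂ F] (E : X → Type*) [∀ x, NormedAddCommGroup (E x)]
    [∀ x, InnerProductSpace ℂ (E x)] [TopologicalSpace (TotalSpace F E)] : Prop
    extends IsBanachBundle F E where
  exists_trivialization : ∀ x : X, ∃ e : Trivialization F (π F E), x ∈ e.baseSet ∧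
    ∀ y ∈ e.baseSet, ∃ L : E y ≃ₗᵢ[ℂ] F, ∀ v : E y, (e ⟨y, v⟩).2 = L v

open Bundle in
/-- Continuity of a section. -/
def IsContinuousSection {X : Type*} [TopologicalSpace X] (F : Type*) (E : X → Type*)
    [TopologicalSpace (TotalSpace F E)] (s : ∀ x, E x) : Prop :=
  Continuous fun x => (⟨x, s x⟩ : TotalSpace F E)

open Bundle in
/-- The topology on the total space generated by a family `Λ` of sections: a subbase is given by
the tubes `{b | π(b) ∈ U, ‖b - γ(π(b))‖ < ε}`, for `γ ∈ Λ`, `U` open and `ε > 0`. -/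
@[reducible]
def tubeTopology {X : Type*} [TopologicalSpace X] (F : Type*) (E : X → Type*)
    [∀ x, NormedAddCommGroup (E x)] (Λ : Set (∀ x, E x)) : TopologicalSpace (TotalSpace F E) :=
  TopologicalSpace.generateFrom {W | ∃ γ ∈ Λ, ∃ U : Set X, IsOpen U ∧ ∃ ε : ℝ, 0 < ε ∧
    W = {b : TotalSpace F E | b.proj ∈ U ∧ ‖b.snd - γ b.proj‖ < ε}}

/-! ## The bundles `𝓔_{d,n}`, `𝔐_{d,n}` and `M_m(𝔐_{d,n})` -/

/-- The tautological bundle `𝓔_{d,n}`. -/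
abbrev tautologicalBundle (d n : ℕ) : coinvariantGrassmannian d n → Type :=
  fun P => TautologicalFibre P

/-- The total space of `𝓔_{d,n}` is topologized as a subspace of `ℙ_{d,n} × H²_d`. -/
noncomputable instance tautologicalTopology (d n : ℕ) : TopologicalSpace
    (Bundle.TotalSpace (EuclideanSpace ℂ (Fin n)) (tautologicalBundle d n)) :=
  TopologicalSpace.induced (fun b => (b.proj, (b.snd : DruryArveson d))) inferInstance

/-- The bundle `𝔐_{d,n}` of compressed multipliers. -/
abbrev multiplierBundle (d n : ℕ) : coinvariantGrassmannian d n → Type :=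
  fun P => MultiplierFibre P

/-- The section `γ_f : P ↦ P M_f|_{P H²_d}` of `𝔐_{d,n}`. -/
noncomputable def multiplierSection {d : ℕ} (n : ℕ) (f : multiplierAlgebra d) :
    ∀ P, multiplierBundle d n P :=
  fun P => ⟨compressionHom P f, f, rfl⟩

/-- The topology of `𝔐_{d,n}`, generated by the sections `γ_f`. -/
noncomputable instance multiplierTopology (d n : ℕ) :
    TopologicalSpace (Bundle.TotalSpace Unit (multiplierBundle d n)) :=
  tubeTopology Unit (multiplierBundle d n) (Set.range (multiplierSection n))

/-- The bundle `M_m(𝔐_{d,n})`. -/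
abbrev amplifiedBundle (m d n : ℕ) : coinvariantGrassmannian d n → Type :=
  fun P => AmplifiedFibre m P

/-- The section `P ↦ (I_m ⊗ P) M_f|_{ℂ^m ⊗ P H²_d}` of `M_m(𝔐_{d,n})`, for a matrix `f` of
multipliers. -/
noncomputable def amplifiedMultiplierSection {m d : ℕ} (n : ℕ)
    (f : Matrix (Fin m) (Fin m) (multiplierAlgebra d)) : ∀ P, amplifiedBundle m d n P :=
  fun P => ⟨matrixOperator m (TautologicalFibre P) (f.map (compressionHom P)), f, rfl⟩

/-- The topology of `M_m(𝔐_{d,n})`, generated by the sections given by `M_m(𝓜_d)`. -/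
noncomputable instance amplifiedTopology (m d n : ℕ) :
    TopologicalSpace (Bundle.TotalSpace Unit (amplifiedBundle m d n)) :=
  tubeTopology Unit (amplifiedBundle m d n) (Set.range (amplifiedMultiplierSection n))

/-- The section of `M_m(𝔐_{d,n})` given by a matrix of sections of `𝔐_{d,n}`. -/
noncomputable def matrixSection {m d n : ℕ}
    (X : Matrix (Fin m) (Fin m) (∀ P, multiplierBundle d n P)) :
    ∀ P, amplifiedBundle m d n P :=
  fun P => ⟨matrixOperator m (TautologicalFibre P) (Matrix.of fun i j => (X i j P).1), by
    choose f hf using fun i j => (X i j P).2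
    exact ⟨Matrix.of f, congrArg (matrixOperator m (TautologicalFibre P))
      (Matrix.ext fun i j => hf i j)⟩⟩

/-- Bounded sections of `𝔐_{d,n}` and of its amplifications. -/
def IsBoundedSection {X : Type*} {E : X → Type*} [∀ x, NormedAddCommGroup (E x)]
    (s : ∀ x, E x) : Prop :=
  ∃ C : ℝ, ∀ x, ‖s x‖ ≤ C

/-- The supremum norm of a matrix of sections of `𝔐_{d,n}`, seen as a section of
`M_m(𝔐_{d,n})`. -/
noncomputable def supMatrixNorm {m d n : ℕ}
    (X : Matrix (Fin m) (Fin m) (∀ P, multiplierBundle d n P)) : ℝ :=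
  ⨆ P, ‖matrixSection X P‖

/-! ## Operator algebras -/

/-- A unital abstract operator algebra: a unital complex algebra `A` with norms `N m` on all the
spaces `M_m(A)`, complete at the first level, which satisfy Ruan's axioms (so that `A` is an
abstract operator space) and the conditions of Blecher, Ruan and Sinclair: matrix multiplication is
contractive at every level and the unit has norm one. The scalar matrices act with their operator
norm between Euclidean spaces. -/
structure IsAbstractOperatorAlgebra (A : Type*) [Ring A] [Algebra ℂ A]
    (N : ∀ m : ℕ, Matrix (Fin m) (Fin m) A → ℝ) : Prop where
  nonneg : ∀ m X, 0 ≤ N m X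
  eq_zero_iff : ∀ m X, N m X = 0 ↔ X = 0
  add_le : ∀ m X Y, N m (X + Y) ≤ N m X + N m Y
  smul_eq : ∀ m (c : ℂ) X, N m (c • X) = ‖c‖ * N m X
  complete : ∀ u : ℕ → A,
    (∀ ε : ℝ, 0 < ε → ∃ k₀ : ℕ, ∀ k ≥ k₀, ∀ l ≥ k₀, N 1 (Matrix.of fun _ _ => u k - u l) < ε) →
    ∃ a : A, ∀ ε : ℝ, 0 < ε → ∃ k₀ : ℕ, ∀ k ≥ k₀, N 1 (Matrix.of fun _ _ => u k - a) < ε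
  directSum : ∀ (m k : ℕ) (X : Matrix (Fin m) (Fin m) A) (Y : Matrix (Fin k) (Fin k) A),
    N (m + k) (Matrix.reindex finSumFinEquiv finSumFinEquiv (Matrix.fromBlocks X 0 0 Y)) =
      max (N m X) (N k Y)
  scalar_mul_le : ∀ (m k : ℕ) (α : Matrix (Fin k) (Fin m) ℂ) (X : Matrix (Fin m) (Fin m) A)
    (β : Matrix (Fin m) (Fin k) ℂ),
    N k (α.map (algebraMap ℂ A) * X * β.map (algebraMap ℂ A)) ≤
      ‖(Matrix.toEuclideanLin α).toContinuousLinearMap‖ * N m X *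
        ‖(Matrix.toEuclideanLin β).toContinuousLinearMap‖
  mul_le : ∀ m X Y, N m (X * Y) ≤ N m X * N m Y
  one_eq : N 1 1 = 1

/-- `A` with the matrix norms `N` is, completely isometrically and unitally, a norm-closed algebra
of bounded operators on a Hilbert space. -/
def IsRepresentedOperatorAlgebra (A : Type) [Ring A] [Algebra ℂ A]
    (N : ∀ m : ℕ, Matrix (Fin m) (Fin m) A → ℝ) : Prop :=
  ∃ (K : Type) (_ : NormedAddCommGroup K) (_ : InnerProductSpace ℂ K) (_ : CompleteSpace K)
    (ρ : A →ₐ[ℂ] (K →L[ℂ] K)), IsClosed (Set.range ρ) ∧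
      ∀ (m : ℕ) (X : Matrix (Fin m) (Fin m) A), ‖matrixOperator m K (X.map ρ)‖ = N m X

/-!
The topology of `𝔐_{d,n}` is that of Fell: the sections `γ_f` exhaust every fibre, and their norms
are continuous, since `P M_f|_{P H²_d}` has the norm of the operator `P M_f P` on `H²_d`, which
depends continuously on `P`. In any Banach bundle a net converges to `s x`, for a continuous section
`s`, if and only if its base points converge to `x` and its distances from `s` tend to `0`; so tubes
around the `γ_f` are the only choice for a topology, and they do give a Banach algebra bundle. The
amplifications are treated in the same way, and a matrix norm is controlled by the norms of the
entries. For the tautological bundle, a basis of the fibre at `P₀` projected to the nearby fibres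
and orthonormalized is a continuous frame.

An element of `Γ_b` acts as a diagonal operator on the Hilbert sum of the spaces `P H²_d`. This
representation is completely isometric, and its range is closed because uniform limits of continuous
sections are continuous; the axioms of an abstract operator algebra follow. The unit has norm `1`
because `ℙ_{d,n}` is nonempty: the span of `n` kernel functions at points of a line through the
origin is coinvariant and, by partial fractions, of dimension `n`.
-/

section

open Bundle Filter Topology

/-! ### Banach bundles and their continuous sections -/

section BanachBundle

variable {X : Type*} {F : Type*} {E : X → Type*}

theorem tendsto_prodBundle [TopologicalSpace (TotalSpace F E)] {ι : Type*} {l : Filter ι}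
    {p : ι → X} {f g : ∀ i, E (p i)} {x : X} {a b : E x}
    (hf : Tendsto (fun i => (⟨p i, f i⟩ : TotalSpace F E)) l (𝓝 ⟨x, a⟩))
    (hg : Tendsto (fun i => (⟨p i, g i⟩ : TotalSpace F E)) l (𝓝 ⟨x, b⟩)) :
    Tendsto (fun i => (⟨p i, (f i, g i)⟩ : TotalSpace (F × F) (E ×ᵇ E))) l (𝓝 ⟨x, (a, b)⟩) :=
  (FiberBundle.Prod.isInducing_diag F E F E).tendsto_nhds_iff.2 (hf.prodMk_nhds hg)

variable [TopologicalSpace X]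

theorem tendsto_proj_tubeTopology [∀ x, NormedAddCommGroup (E x)] {Λ : Set (∀ x, E x)}
    {s : ∀ x, E x} (hs : s ∈ Λ) (x : X) :
    Tendsto (π F E) (@nhds _ (tubeTopology F E Λ) ⟨x, s x⟩) (𝓝 x) := by
  let _ := tubeTopology F E Λ
  intro U hU
  obtain ⟨V, hVU, hV, hxV⟩ := mem_nhds_iff.1 hU
  refine mem_map.2 (mem_of_superset (IsOpen.mem_nhds
    (TopologicalSpace.isOpen_generateFrom_of_mem ⟨s, hs, V, hV, 1, one_pos, rfl⟩) ?_)
    fun c hc => hVU hc.1)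
  simpa using hxV

theorem tendsto_norm_sub_tubeTopology [∀ x, NormedAddCommGroup (E x)] {Λ : Set (∀ x, E x)}
    {s : ∀ x, E x} (hs : s ∈ Λ) (x : X) :
    Tendsto (fun b : TotalSpace F E => ‖b.snd - s b.proj‖)
      (@nhds _ (tubeTopology F E Λ) ⟨x, s x⟩) (𝓝 0) := by
  let _ := tubeTopology F E Λ
  refine Metric.tendsto_nhds.2 fun ε hε => mem_of_superset (IsOpen.mem_nhds
    (TopologicalSpace.isOpen_generateFrom_of_mem ⟨s, hs, Set.univ, isOpen_univ, ε, hε, rfl⟩) ?_)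
    fun c hc => ?_
  · simpa using hε
  · simpa using hc.2

namespace IsBanachBundle

variable [∀ x, NormedAddCommGroup (E x)] [∀ x, NormedSpace ℂ (E x)]
  [τ : TopologicalSpace (TotalSpace F E)]

theorem tendsto_add (hE : IsBanachBundle F E) {ι : Type*} {l : Filter ι}
    {p : ι → X} {f g : ∀ i, E (p i)} {x : X} {a b : E x}
    (hf : Tendsto (fun i => (⟨p i, f i⟩ : TotalSpace F E)) l (𝓝 ⟨x, a⟩))
    (hg : Tendsto (fun i => (⟨p i, g i⟩ : TotalSpace F E)) l (𝓝 ⟨x, b⟩)) :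
    Tendsto (fun i => (⟨p i, f i + g i⟩ : TotalSpace F E)) l (𝓝 ⟨x, a + b⟩) :=
  (hE.continuous_add.tendsto _).comp (tendsto_prodBundle hf hg)

theorem continuous_norm_sub (hE : IsBanachBundle F E) {s : ∀ x, E x}
    (hs : IsContinuousSection F E s) :
    Continuous fun b : TotalSpace F E => ‖b.snd - s b.proj‖ := by
  refine continuous_iff_continuousAt.2 fun b => ?_
  have hneg : Tendsto (fun c : TotalSpace F E => (⟨c.proj, (-1 : ℂ) • s c.proj⟩ : TotalSpace F E))
      (𝓝 b) (𝓝 ⟨b.proj, (-1 : ℂ) • s b.proj⟩) :=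
    ((hE.continuous_smul (-1)).comp (hs.comp hE.continuous_proj)).tendsto b
  simpa [Function.comp_def, ContinuousAt, sub_eq_add_neg] using
    (hE.continuous_norm.tendsto _).comp (hE.tendsto_add (tendsto_id (x := 𝓝 b)) hneg)

theorem tendsto_of_tendsto_norm_sub (hE : IsBanachBundle F E) {s : ∀ x, E x}
    (hs : IsContinuousSection F E s) {ι : Type*} {l : Filter ι} {f : ι → TotalSpace F E} {x : X}
    (hproj : Tendsto (fun i => (f i).proj) l (𝓝 x))
    (hnorm : Tendsto (fun i => ‖(f i).snd - s (f i).proj‖) l (𝓝 0)) :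
    Tendsto f l (𝓝 ⟨x, s x⟩) := by
  have hdiff : Tendsto (fun i => (⟨(f i).proj, (f i).snd - s (f i).proj⟩ : TotalSpace F E))
      l (𝓝 ⟨x, 0⟩) := by
    refine Tendsto.mono_right (tendsto_inf.2 ⟨?_, ?_⟩) (hE.tendsto_zero x)
    exacts [tendsto_comap_iff.2 hnorm, tendsto_comap_iff.2 hproj]
  simpa only [sub_add_cancel, zero_add] using hE.tendsto_add hdiff ((hs.tendsto x).comp hproj)

theorem tendsto_iff (hE : IsBanachBundle F E) {s : ∀ x, E x}
    (hs : IsContinuousSection F E s) {ι : Type*} {l : Filter ι} {f : ι → TotalSpace F E} {x : X} :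
    Tendsto f l (𝓝 ⟨x, s x⟩) ↔ Tendsto (fun i => (f i).proj) l (𝓝 x) ∧
      Tendsto (fun i => ‖(f i).snd - s (f i).proj‖) l (𝓝 0) := by
  refine ⟨fun hf => ⟨(hE.continuous_proj.tendsto _).comp hf, ?_⟩,
    fun h => hE.tendsto_of_tendsto_norm_sub hs h.1 h.2⟩
  simpa [Function.comp_def] using ((hE.continuous_norm_sub hs).tendsto _).comp hf

theorem continuousAt_section_iff (hE : IsBanachBundle F E) {s t : ∀ x, E x}
    (hs : IsContinuousSection F E s) {x : X} (hst : s x = t x) :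
    ContinuousAt (fun y => (⟨y, t y⟩ : TotalSpace F E)) x ↔
      Tendsto (fun y => ‖t y - s y‖) (𝓝 x) (𝓝 0) := by
  rw [ContinuousAt, ← hst, hE.tendsto_iff hs]
  exact and_iff_right tendsto_id

theorem eq_tubeTopology (hE : IsBanachBundle F E) {Λ : Set (∀ x, E x)}
    (hc : ∀ s ∈ Λ, IsContinuousSection F E s) (hΛ : ∀ x (e : E x), ∃ s ∈ Λ, s x = e) :
    τ = tubeTopology F E Λ := by
  refine le_antisymm (le_generateFrom ?_) (le_of_nhds_le_nhds fun b => ?_)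
  · rintro _ ⟨s, hs, U, hU, ε, _, rfl⟩
    exact (hU.preimage hE.continuous_proj).inter
      (isOpen_Iio.preimage (hE.continuous_norm_sub (hc s hs)))
  · obtain ⟨x, e⟩ := b
    obtain ⟨s, hs, rfl⟩ := hΛ x e
    exact hE.tendsto_of_tendsto_norm_sub (f := id) (hc s hs) (tendsto_proj_tubeTopology hs x)
      (tendsto_norm_sub_tubeTopology hs x)

theorem isContinuousSection_of_uniform_limit (hE : IsBanachBundle F E)
    (hsec : ∀ x (e : E x), ∃ s, IsContinuousSection F E s ∧ s x = e) {t : ∀ x, E x}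
    (ht : ∀ ε > 0, ∃ s, IsContinuousSection F E s ∧ ∀ x, ‖s x - t x‖ ≤ ε) :
    IsContinuousSection F E t := by
  refine continuous_iff_continuousAt.2 fun x => ?_
  obtain ⟨r, hr, hrx⟩ := hsec x (t x)
  rw [hE.continuousAt_section_iff hr hrx, Metric.tendsto_nhds]
  intro ε hε
  obtain ⟨s, hs, hst⟩ := ht (ε / 3) (div_pos hε three_pos)
  have hsr : Tendsto (fun y => ‖s y - r y‖) (𝓝 x) (𝓝 ‖s x - r x‖) :=
    ((hE.continuous_norm_sub hr).comp hs).tendsto x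
  have hsrx : ‖s x - r x‖ < ε / 2 := by
    rw [hrx]
    linarith [hst x]
  filter_upwards [hsr.eventually_lt_const hsrx] with y hy
  have htri := norm_sub_le_norm_sub_add_norm_sub (t y) (s y) (r y)
  rw [norm_sub_rev (t y) (s y)] at htri
  rw [dist_zero_right, norm_norm]
  linarith [hst y]

theorem isContinuousSection_add (hE : IsBanachBundle F E) {s t : ∀ x, E x}
    (hs : IsContinuousSection F E s) (ht : IsContinuousSection F E t) :
    IsContinuousSection F E (s + t) :=
  continuous_iff_continuousAt.2 fun x => hE.tendsto_add (hs.tendsto x) (ht.tendsto x)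

theorem isContinuousSection_smul (hE : IsBanachBundle F E) (c : ℂ) {s : ∀ x, E x}
    (hs : IsContinuousSection F E s) : IsContinuousSection F E (c • s) :=
  (hE.continuous_smul c).comp hs

end IsBanachBundle

theorem IsBanachAlgebraBundle.isContinuousSection_mul [∀ x, NormedRing (E x)]
    [∀ x, NormedAlgebra ℂ (E x)] [TopologicalSpace (TotalSpace F E)]
    (hE : IsBanachAlgebraBundle F E) {s t : ∀ x, E x}
    (hs : IsContinuousSection F E s) (ht : IsContinuousSection F E t) :
    IsContinuousSection F E (s * t) :=
  continuous_iff_continuousAt.2 fun x =>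
    (hE.continuous_mul.tendsto _).comp (tendsto_prodBundle (hs.tendsto x) (ht.tendsto x))

end BanachBundle

/-! ### Bundles generated by a linear family of sections -/

section FellFamily

variable {X : Type*} [TopologicalSpace X] {F : Type*} {E : X → Type*}

/-- A linear family of sections, parametrized by a complex vector space, from which the topology of
the total space can be recovered: the sections have continuous norms and exhaust every fibre, and
their tubes generate the topology. -/
structure IsFellFamily (F : Type*) {E : X → Type*} [∀ x, NormedAddCommGroup (E x)]
    [∀ x, NormedSpace ℂ (E x)] [τ : TopologicalSpace (TotalSpace F E)] {A : Type*}
    [AddCommGroup A] [Module ℂ A] (γ : A →ₗ[ℂ] ∀ x, E x) : Prop where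
  surjective : ∀ x, Function.Surjective fun a => γ a x
  continuous_norm : ∀ a, Continuous fun x => ‖γ a x‖
  eq_tubeTopology : τ = tubeTopology F E (Set.range γ)

namespace IsFellFamily

variable [∀ x, NormedAddCommGroup (E x)] [∀ x, NormedSpace ℂ (E x)]
  [τ : TopologicalSpace (TotalSpace F E)] {A : Type*} [AddCommGroup A] [Module ℂ A]
  {γ : A →ₗ[ℂ] ∀ x, E x}

theorem exists_eq (h : IsFellFamily F γ) (b : TotalSpace F E) :
    ∃ x a, (⟨x, γ a x⟩ : TotalSpace F E) = b := by
  obtain ⟨x, e⟩ := b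
  obtain ⟨a, rfl⟩ := h.surjective x e
  exact ⟨x, a, rfl⟩

theorem tendsto_iff (h : IsFellFamily F γ) {ι : Type*} {l : Filter ι} {f : ι → TotalSpace F E}
    {x : X} {a : A} :
    Tendsto f l (𝓝 ⟨x, γ a x⟩) ↔ Tendsto (fun i => (f i).proj) l (𝓝 x) ∧
      Tendsto (fun i => ‖(f i).snd - γ a (f i).proj‖) l (𝓝 0) := by
  rw [h.eq_tubeTopology]
  refine ⟨fun hf => ⟨(tendsto_proj_tubeTopology (Set.mem_range_self a) x).comp hf,
    (tendsto_norm_sub_tubeTopology (Set.mem_range_self a) x).comp hf⟩, fun ⟨hproj, hnorm⟩ => ?_⟩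
  rw [TopologicalSpace.tendsto_nhds_generateFrom_iff]
  rintro _ ⟨_, ⟨b, rfl⟩, U, hU, ε, _, rfl⟩ ⟨hxU, hxε⟩
  have hsum : Tendsto (fun i => ‖(f i).snd - γ a (f i).proj‖ + ‖γ (a - b) (f i).proj‖) l
      (𝓝 (0 + ‖γ (a - b) x‖)) :=
    hnorm.add (((h.continuous_norm (a - b)).tendsto x).comp hproj)
  have hlt : 0 + ‖γ (a - b) x‖ < ε := by simpa using hxε
  filter_upwards [hproj.eventually (hU.mem_nhds hxU), hsum.eventually_lt_const hlt] with i hi hi'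
  refine ⟨hi, lt_of_le_of_lt ?_ hi'⟩
  simpa using norm_add_le ((f i).snd - γ a (f i).proj) (γ a (f i).proj - γ b (f i).proj)

theorem continuous_proj (h : IsFellFamily F γ) : Continuous (π F E) :=
  continuous_iff_continuousAt.2 fun b => by
    obtain ⟨x, a, rfl⟩ := h.exists_eq b
    exact (h.tendsto_iff.1 tendsto_id).1

theorem isContinuousSection (h : IsFellFamily F γ) (a : A) : IsContinuousSection F E (γ a) :=
  continuous_iff_continuousAt.2 fun x => h.tendsto_iff.2 ⟨tendsto_id, by simp⟩

theorem isOpenMap_proj (h : IsFellFamily F γ) : IsOpenMap (π F E) := by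
  refine fun W hW => isOpen_iff_mem_nhds.2 ?_
  rintro _ ⟨b, hb, rfl⟩
  obtain ⟨x, a, rfl⟩ := h.exists_eq b
  exact mem_of_superset ((hW.preimage (h.isContinuousSection a)).mem_nhds hb)
    fun y hy => ⟨_, hy, rfl⟩

theorem continuous_norm_sub (h : IsFellFamily F γ) (a : A) :
    Continuous fun b : TotalSpace F E => ‖b.snd - γ a b.proj‖ := by
  refine continuous_iff_continuousAt.2 fun b => ?_
  obtain ⟨x, c, rfl⟩ := h.exists_eq b
  obtain ⟨hproj, hnorm⟩ := h.tendsto_iff.1 (tendsto_id (x := 𝓝 (⟨x, γ c x⟩ : TotalSpace F E)))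
  have hsub : Tendsto (fun b : TotalSpace F E => ‖γ (c - a) b.proj‖) (𝓝 ⟨x, γ c x⟩)
      (𝓝 ‖γ (c - a) x‖) :=
    ((h.continuous_norm _).tendsto _).comp hproj
  have hdiff : Tendsto (fun b : TotalSpace F E => ‖b.snd - γ a b.proj‖ - ‖γ (c - a) b.proj‖)
      (𝓝 ⟨x, γ c x⟩) (𝓝 0) := by
    refine squeeze_zero_norm (fun b => ?_) hnorm
    simpa using abs_norm_sub_norm_le (b.snd - γ a b.proj) (γ c b.proj - γ a b.proj)
  simpa [ContinuousAt] using hdiff.add hsub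

theorem continuous_norm_totalSpace (h : IsFellFamily F γ) :
    Continuous fun b : TotalSpace F E => ‖b.snd‖ := by
  simpa using h.continuous_norm_sub 0

theorem t2Space [T2Space X] (h : IsFellFamily F γ) : T2Space (TotalSpace F E) := by
  refine ⟨fun b c hbc => ?_⟩
  by_cases hp : b.proj = c.proj
  · obtain ⟨x, a, rfl⟩ := h.exists_eq b
    obtain ⟨_, e⟩ := c
    obtain rfl : x = _ := hp
    have hpos : 0 < ‖e - γ a x‖ :=
      norm_pos_iff.2 (sub_ne_zero.2 fun he => hbc (congrArg (TotalSpace.mk x) he.symm))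
    exact separated_by_continuous (h.continuous_norm_sub a) (by simpa using hpos.ne)
  · exact separated_by_continuous h.continuous_proj hp

theorem tendsto_zero (h : IsFellFamily F γ) (x : X) :
    comap (fun b : TotalSpace F E => ‖b.snd‖) (𝓝 0) ⊓ comap (π F E) (𝓝 x) ≤
      𝓝 (⟨x, 0⟩ : TotalSpace F E) := by
  have hnorm : Tendsto (fun b : TotalSpace F E => ‖b.snd‖)
      (comap (fun b : TotalSpace F E => ‖b.snd‖) (𝓝 0) ⊓ comap (π F E) (𝓝 x)) (𝓝 0) :=
    tendsto_comap.mono_left inf_le_left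
  have hzero := (h.tendsto_iff (f := id) (x := x) (a := 0)).2
    ⟨tendsto_comap.mono_left inf_le_right, by simpa using hnorm⟩
  simpa using tendsto_id'.1 hzero

theorem continuous_smul (h : IsFellFamily F γ) (c : ℂ) :
    Continuous fun b : TotalSpace F E => (⟨b.proj, c • b.snd⟩ : TotalSpace F E) := by
  refine continuous_iff_continuousAt.2 fun b => ?_
  obtain ⟨x, a, rfl⟩ := h.exists_eq b
  have hlim : Tendsto (fun b : TotalSpace F E => (⟨b.proj, c • b.snd⟩ : TotalSpace F E))
      (𝓝 ⟨x, γ a x⟩) (𝓝 ⟨x, γ (c • a) x⟩) :=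
    h.tendsto_iff.2 ⟨h.continuous_proj.tendsto _, by
      simpa [← smul_sub, norm_smul] using
        ((h.continuous_norm_sub a).tendsto (⟨x, γ a x⟩ : TotalSpace F E)).const_mul ‖c‖⟩
  simpa [ContinuousAt] using hlim

theorem continuous_add (h : IsFellFamily F γ) :
    Continuous fun b : TotalSpace (F × F) (E ×ᵇ E) =>
      (⟨b.proj, b.snd.1 + b.snd.2⟩ : TotalSpace F E) := by
  refine continuous_iff_continuousAt.2 ?_
  rintro ⟨x, u, v⟩
  obtain ⟨a, rfl⟩ := h.surjective x u
  obtain ⟨b, rfl⟩ := h.surjective x v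
  have hdiag := (FiberBundle.Prod.isInducing_diag F E F E).continuous.tendsto
    ⟨x, (γ a x, γ b x)⟩
  obtain ⟨hproj, ha⟩ := h.tendsto_iff.1 hdiag.fst_nhds
  obtain ⟨-, hb⟩ := h.tendsto_iff.1 hdiag.snd_nhds
  have hlim : Tendsto (fun c : TotalSpace (F × F) (E ×ᵇ E) =>
      (⟨c.proj, c.snd.1 + c.snd.2⟩ : TotalSpace F E))
      (𝓝 ⟨x, (γ a x, γ b x)⟩) (𝓝 ⟨x, γ (a + b) x⟩) := by
    refine h.tendsto_iff.2 ⟨hproj, squeeze_zero (fun _ => norm_nonneg _) (fun c => ?_)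
      (by simpa only [add_zero] using ha.add hb)⟩
    simpa [add_sub_add_comm] using norm_add_le (c.snd.1 - γ a c.proj) (c.snd.2 - γ b c.proj)
  simpa [ContinuousAt] using hlim

theorem isBanachBundle [T2Space X] [∀ x, CompleteSpace (E x)] (h : IsFellFamily F γ) :
    IsBanachBundle F E where
  t2Space := h.t2Space
  completeSpace := inferInstance
  continuous_proj := h.continuous_proj
  isOpenMap_proj := h.isOpenMap_proj
  continuous_norm := h.continuous_norm_totalSpace
  continuous_add := h.continuous_add
  continuous_smul := h.continuous_smul
  tendsto_zero := h.tendsto_zero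

theorem exists_isContinuousSection_eq (h : IsFellFamily F γ) (x : X) (e : E x) :
    ∃ s, IsContinuousSection F E s ∧ s x = e := by
  obtain ⟨a, rfl⟩ := h.surjective x e
  exact ⟨γ a, h.isContinuousSection a, rfl⟩

end IsFellFamily

theorem IsFellFamily.eq_of_isBanachBundle [∀ x, NormedAddCommGroup (E x)]
    [∀ x, NormedSpace ℂ (E x)] {τ' τ : TopologicalSpace (TotalSpace F E)} {A : Type*}
    [AddCommGroup A] [Module ℂ A] {γ : A →ₗ[ℂ] ∀ x, E x} (h : IsFellFamily F γ)
    (hE : @IsBanachBundle _ _ F E _ _ τ') (hγ : ∀ a, @IsContinuousSection _ _ F E τ' (γ a)) :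
    τ' = τ := by
  refine Eq.trans (@IsBanachBundle.eq_tubeTopology _ F E _ _ _ τ' hE _
    (Set.forall_mem_range.2 hγ) fun x e => ?_) h.eq_tubeTopology.symm
  obtain ⟨a, rfl⟩ := h.surjective x e
  exact ⟨γ a, Set.mem_range_self a, rfl⟩

theorem IsFellFamily.isBanachAlgebraBundle [T2Space X] [∀ x, NormedRing (E x)]
    [∀ x, NormedAlgebra ℂ (E x)] [∀ x, CompleteSpace (E x)] [TopologicalSpace (TotalSpace F E)]
    {A : Type*} [Ring A] [Algebra ℂ A] {γ : A →ₐ[ℂ] ∀ x, E x}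
    (h : IsFellFamily F γ.toLinearMap) : IsBanachAlgebraBundle F E where
  toIsBanachBundle := h.isBanachBundle
  continuous_mul := by
    refine continuous_iff_continuousAt.2 ?_
    rintro ⟨x, u, v⟩
    obtain ⟨a, rfl⟩ := h.surjective x u
    obtain ⟨b, rfl⟩ := h.surjective x v
    have hdiag := (FiberBundle.Prod.isInducing_diag F E F E).continuous.tendsto
      ⟨x, (γ a x, γ b x)⟩
    obtain ⟨hproj, ha⟩ := h.tendsto_iff.1 hdiag.fst_nhds
    obtain ⟨-, hb⟩ := h.tendsto_iff.1 hdiag.snd_nhds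
    have hlim : Tendsto (fun c : TotalSpace (F × F) (E ×ᵇ E) =>
        (⟨c.proj, c.snd.1 * c.snd.2⟩ : TotalSpace F E))
        (𝓝 ⟨x, (γ a x, γ b x)⟩) (𝓝 ⟨x, γ (a * b) x⟩) := by
      have hvanish := (ha.mul ((h.continuous_norm_totalSpace.tendsto _).comp hdiag.snd_nhds)).add
        ((((h.continuous_norm a).tendsto _).comp hproj).mul hb)
      simp only [zero_mul, mul_zero, add_zero] at hvanish
      refine h.tendsto_iff.2 ⟨hproj, squeeze_zero (fun _ => norm_nonneg _) (fun c => ?_) hvanish⟩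
      calc ‖c.snd.1 * c.snd.2 - γ (a * b) c.proj‖
          = ‖(c.snd.1 - γ a c.proj) * c.snd.2 + γ a c.proj * (c.snd.2 - γ b c.proj)‖ := by
            rw [map_mul, Pi.mul_apply]
            noncomm_ring
        _ ≤ _ := (norm_add_le _ _).trans (add_le_add (norm_mul_le _ _) (norm_mul_le _ _))
    simpa [ContinuousAt] using hlim

end FellFamily

section BoundedSections

variable {X : Type*} [TopologicalSpace X] {F : Type*} {E : X → Type*} [∀ x, NormedRing (E x)]
  [∀ x, NormedAlgebra ℂ (E x)] [TopologicalSpace (TotalSpace F E)]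

/-- The algebra of bounded continuous sections of a Banach algebra bundle whose fibrewise unit is
continuous and bounded. -/
def boundedSections (hE : IsBanachAlgebraBundle F E) (hone : IsContinuousSection F E 1)
    (hbdd : IsBoundedSection (1 : ∀ x, E x)) : Subalgebra ℂ (∀ x, E x) where
  carrier := {s | IsContinuousSection F E s ∧ IsBoundedSection s}
  mul_mem' := by
    rintro s t ⟨hs, C, hC⟩ ⟨ht, D, hD⟩
    refine ⟨hE.isContinuousSection_mul hs ht, C * D, fun x => (norm_mul_le _ _).trans ?_⟩
    exact mul_le_mul (hC x) (hD x) (norm_nonneg _) ((norm_nonneg _).trans (hC x))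
  add_mem' := by
    rintro s t ⟨hs, C, hC⟩ ⟨ht, D, hD⟩
    exact ⟨hE.isContinuousSection_add hs ht, C + D,
      fun x => (norm_add_le _ _).trans (add_le_add (hC x) (hD x))⟩
  algebraMap_mem' c := by
    obtain ⟨C, hC⟩ := hbdd
    rw [Algebra.algebraMap_eq_smul_one]
    refine ⟨hE.isContinuousSection_smul c hone, ‖c‖ * C, fun x => ?_⟩
    rw [Pi.smul_apply, norm_smul]
    exact mul_le_mul_of_nonneg_left (hC x) (norm_nonneg c)

end BoundedSections

/-! ### Bundles of subspaces and orthonormal frames -/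

section SubspaceBundle

variable {X : Type*} [TopologicalSpace X] {F H : Type*} [NormedAddCommGroup H] [NormedSpace ℂ H]

/-- The disjoint union of the subspaces `V x`, topologized as a subspace of `X × H`, for a family
of subspaces which are the ranges of strongly continuous idempotents `P x`. -/
structure IsSubspaceBundle (F : Type*) (V : X → Submodule ℂ H)
    [TopologicalSpace (TotalSpace F fun x => V x)] (P : X → H →L[ℂ] H) : Prop where
  isInducing : IsInducing fun b : TotalSpace F fun x => V x => (b.proj, (b.snd : H))
  continuous_apply : ∀ h, Continuous fun x => P x h
  apply_mem : ∀ x h, P x h ∈ V x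
  apply_coe : ∀ x (v : V x), P x v = v

namespace IsSubspaceBundle

variable {V : X → Submodule ℂ H} [TopologicalSpace (TotalSpace F fun x => V x)]
  {P : X → H →L[ℂ] H}

theorem continuous_proj (h : IsSubspaceBundle F V P) : Continuous (π F fun x => V x) :=
  continuous_fst.comp h.isInducing.continuous

theorem continuous_coe_snd (h : IsSubspaceBundle F V P) :
    Continuous fun b : TotalSpace F fun x => V x => (b.snd : H) :=
  continuous_snd.comp h.isInducing.continuous

theorem t2Space [T2Space X] (h : IsSubspaceBundle F V P) :
    T2Space (TotalSpace F fun x => V x) := by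
  refine T2Space.of_injective_continuous (fun b c hbc => ?_) h.isInducing.continuous
  obtain ⟨x, v⟩ := b
  obtain ⟨y, w⟩ := c
  obtain ⟨hproj, hsnd⟩ := Prod.ext_iff.1 hbc
  obtain rfl : x = y := hproj
  exact congrArg (TotalSpace.mk x) (Subtype.ext hsnd)

theorem isContinuousSection (h : IsSubspaceBundle F V P) (v : H) :
    IsContinuousSection F (fun x => V x) fun x => ⟨P x v, h.apply_mem x v⟩ :=
  h.isInducing.continuous_iff.2 (continuous_id.prodMk (h.continuous_apply v))

theorem isOpenMap_proj (h : IsSubspaceBundle F V P) : IsOpenMap (π F fun x => V x) := by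
  refine fun W hW => isOpen_iff_mem_nhds.2 ?_
  rintro _ ⟨⟨x, v⟩, hb, rfl⟩
  refine mem_of_superset ((hW.preimage (h.isContinuousSection (v : H))).mem_nhds ?_)
    fun y hy => ⟨_, hy, rfl⟩
  simpa only [Set.mem_preimage, h.apply_coe] using hb

theorem tendsto_zero (h : IsSubspaceBundle F V P) (x : X) :
    comap (fun b : TotalSpace F fun x => V x => ‖b.snd‖) (𝓝 0) ⊓ comap (π F fun x => V x) (𝓝 x) ≤
      𝓝 (⟨x, 0⟩ : TotalSpace F fun x => V x) := by
  rw [h.isInducing.nhds_eq_comap, ← map_le_iff_le_comap, nhds_prod_eq]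
  refine (tendsto_comap.mono_left inf_le_right).prodMk (tendsto_zero_iff_norm_tendsto_zero.2 ?_)
  exact tendsto_comap.mono_left inf_le_left

theorem isBanachBundle [T2Space X] [∀ x, CompleteSpace (V x)] (h : IsSubspaceBundle F V P) :
    IsBanachBundle F fun x => V x where
  t2Space := h.t2Space
  completeSpace := inferInstance
  continuous_proj := h.continuous_proj
  isOpenMap_proj := h.isOpenMap_proj
  continuous_norm := h.continuous_coe_snd.norm
  continuous_add := by
    have hdiag := (FiberBundle.Prod.isInducing_diag F (fun x => V x) F fun x => V x).continuous
    exact h.isInducing.continuous_iff.2 ((h.continuous_proj.comp hdiag.fst).prodMk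
      ((h.continuous_coe_snd.comp hdiag.fst).add (h.continuous_coe_snd.comp hdiag.snd)))
  continuous_smul c :=
    h.isInducing.continuous_iff.2 (h.continuous_proj.prodMk (h.continuous_coe_snd.const_smul c))
  tendsto_zero := h.tendsto_zero

end IsSubspaceBundle

end SubspaceBundle

section GramSchmidt

open InnerProductSpace

variable {X 𝕜 H ι : Type*} [TopologicalSpace X] [RCLike 𝕜] [NormedAddCommGroup H]
  [InnerProductSpace 𝕜 H] [LinearOrder ι] [LocallyFiniteOrderBot ι] [WellFoundedLT ι]
  {v : X → ι → H} {s : Set X}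

theorem continuousOn_gramSchmidt (hv : ∀ i, ContinuousOn (fun x => v x i) s)
    (hs : ∀ x ∈ s, LinearIndependent 𝕜 (v x)) (i : ι) :
    ContinuousOn (fun x => gramSchmidt 𝕜 (v x) i) s := by
  induction i using WellFoundedLT.induction with
  | ind i ih =>
    have hrec : (fun x => gramSchmidt 𝕜 (v x) i) = fun x => v x i -
        ∑ j ∈ Finset.Iio i, (inner 𝕜 (gramSchmidt 𝕜 (v x) j) (v x i) /
          (‖gramSchmidt 𝕜 (v x) j‖ : 𝕜) ^ 2) • gramSchmidt 𝕜 (v x) j :=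
      funext fun x => eq_sub_of_add_eq (gramSchmidt_def'' 𝕜 (v x) i).symm
    rw [hrec]
    refine (hv i).sub (continuousOn_finsetSum _ fun j hj => ?_)
    have hj' := ih j (Finset.mem_Iio.1 hj)
    refine ((hj'.inner (hv i)).div ?_ fun x hx => ?_).smul hj'
    · exact (RCLike.continuous_ofReal.comp_continuousOn hj'.norm).pow 2
    · simpa using gramSchmidt_ne_zero (𝕜 := 𝕜) j (hs x hx)

theorem continuousOn_gramSchmidtNormed (hv : ∀ i, ContinuousOn (fun x => v x i) s)
    (hs : ∀ x ∈ s, LinearIndependent 𝕜 (v x)) (i : ι) :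
    ContinuousOn (fun x => gramSchmidtNormed 𝕜 (v x) i) s := by
  have h := continuousOn_gramSchmidt hv hs i
  refine (ContinuousOn.inv₀ ?_ fun x hx => ?_).smul h
  · exact RCLike.continuous_ofReal.comp_continuousOn h.norm
  · simpa using gramSchmidt_ne_zero (𝕜 := 𝕜) i (hs x hx)

theorem gramSchmidtNormed_mem {K : Submodule 𝕜 H} {w : ι → H} (hw : ∀ i, w i ∈ K) (i : ι) :
    gramSchmidtNormed 𝕜 w i ∈ K := by
  have hspan : Submodule.span 𝕜 (Set.range (gramSchmidtNormed 𝕜 w)) ≤ K := by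
    rw [span_gramSchmidtNormed_range, span_gramSchmidt, Submodule.span_le]
    exact Set.range_subset_iff.2 hw
  exact hspan (Submodule.subset_span (Set.mem_range_self i))

end GramSchmidt

section OrthonormalFrame

variable {X H ι : Type*} [TopologicalSpace X] [NormedAddCommGroup H] [InnerProductSpace ℂ H]
  [Fintype ι] {V : X → Submodule ℂ H}

/-- A continuous orthonormal frame over `U` of a bundle of subspaces of `H`. -/
structure IsOrthonormalFrame (e : ι → ∀ x, V x) (U : Set X) : Prop where
  isOpen : IsOpen U
  continuousOn : ∀ i, ContinuousOn (fun x => (e i x : H)) U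
  orthonormal : ∀ x ∈ U, Orthonormal ℂ fun i => e i x
  top_le_span : ∀ x ∈ U, ⊤ ≤ Submodule.span ℂ (Set.range fun i => e i x)

namespace IsOrthonormalFrame

variable {e : ι → ∀ x, V x} {U : Set X}

/-- The orthonormal basis of the fibre at `x` given by an orthonormal frame. -/
noncomputable def basis (h : IsOrthonormalFrame e U) {x : X} (hx : x ∈ U) :
    OrthonormalBasis ι ℂ (V x) :=
  OrthonormalBasis.mk (h.orthonormal x hx) (h.top_le_span x hx)

theorem basis_apply (h : IsOrthonormalFrame e U) {x : X} (hx : x ∈ U) (i : ι) :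
    h.basis hx i = e i x :=
  congrFun (OrthonormalBasis.coe_mk (h.orthonormal x hx) _) i

theorem basis_repr (h : IsOrthonormalFrame e U) {x : X} (hx : x ∈ U) (v : V x) :
    (h.basis hx).repr v = WithLp.toLp 2 fun i => inner ℂ (e i x) v := by
  ext i
  rw [OrthonormalBasis.repr_apply_apply, h.basis_apply]

theorem basis_repr_symm (h : IsOrthonormalFrame e U) {x : X} (hx : x ∈ U)
    (c : EuclideanSpace ℂ ι) : (h.basis hx).repr.symm c = ∑ i, c i • e i x := by
  simp [← (h.basis hx).sum_repr_symm, h.basis_apply]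

variable [TopologicalSpace (TotalSpace (EuclideanSpace ℂ ι) fun x => V x)]
  {P : X → H →L[ℂ] H}

/-- The fibrewise unitary trivialization given by an orthonormal frame. -/
noncomputable def trivialization (h : IsOrthonormalFrame e U)
    (hV : IsSubspaceBundle (EuclideanSpace ℂ ι) V P) :
    Trivialization (EuclideanSpace ℂ ι) (π (EuclideanSpace ℂ ι) fun x => V x) where
  toFun b := (b.proj, WithLp.toLp 2 fun i => inner ℂ (e i b.proj) b.snd)
  invFun p := ⟨p.1, ∑ i, p.2 i • e i p.1⟩
  source := π _ _ ⁻¹' U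
  target := U ×ˢ Set.univ
  baseSet := U
  map_source' _ hb := ⟨hb, trivial⟩
  map_target' _ hp := hp.1
  left_inv' := by
    rintro ⟨x, v⟩ hx
    refine congrArg (TotalSpace.mk x) ?_
    rw [← h.basis_repr hx, ← h.basis_repr_symm hx, LinearIsometryEquiv.symm_apply_apply]
  right_inv' := by
    rintro ⟨x, c⟩ ⟨hx, -⟩
    refine congrArg (Prod.mk x) ?_
    rw [← h.basis_repr hx, ← h.basis_repr_symm hx, LinearIsometryEquiv.apply_symm_apply]
  open_source := h.isOpen.preimage hV.continuous_proj
  open_target := h.isOpen.prod isOpen_univ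
  continuousOn_toFun := by
    refine hV.continuous_proj.continuousOn.prodMk
      ((PiLp.continuous_toLp 2 _).comp_continuousOn (continuousOn_pi.2 fun i => ?_))
    exact ((h.continuousOn i).comp hV.continuous_proj.continuousOn fun _ hb => hb).inner
      hV.continuous_coe_snd.continuousOn
  continuousOn_invFun := by
    refine hV.isInducing.continuousOn_iff.2 (continuousOn_fst.prodMk ?_)
    simp only [Submodule.coe_sum, Submodule.coe_smul]
    refine continuousOn_finsetSum _ fun i _ => ContinuousOn.fun_smul ?_ ?_
    · exact ((PiLp.continuous_apply 2 _ i).comp continuous_snd).continuousOn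
    · exact (h.continuousOn i).comp continuousOn_fst fun _ hp => hp.1
  open_baseSet := h.isOpen
  source_eq := rfl
  target_eq := rfl
  proj_toFun _ _ := rfl

end IsOrthonormalFrame

namespace IsSubspaceBundle

variable {n : ℕ} [TopologicalSpace (TotalSpace (EuclideanSpace ℂ (Fin n)) fun x => V x)]
  {P : X → H →L[ℂ] H}

/-- Near `x₀`, the Gram–Schmidt process applied to the projections of a basis of `V x₀` is a frame:
linear independence is an open condition. -/
theorem exists_isOrthonormalFrame (hV : IsSubspaceBundle (EuclideanSpace ℂ (Fin n)) V P)
    [∀ x, FiniteDimensional ℂ (V x)] (hn : ∀ x, Module.finrank ℂ (V x) = n) (x₀ : X) :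
    ∃ (e : Fin n → ∀ x, V x) (U : Set X), x₀ ∈ U ∧ IsOrthonormalFrame e U := by
  let b := (stdOrthonormalBasis ℂ (V x₀)).reindex (finCongr (hn x₀))
  let w (x : X) (i : Fin n) : H := P x (b i)
  let U : Set X := {x | LinearIndependent ℂ (w x)}
  let e (i : Fin n) (x : X) : V x :=
    ⟨InnerProductSpace.gramSchmidtNormed ℂ (w x) i,
      gramSchmidtNormed_mem (fun _ => hV.apply_mem x _) i⟩
  have hw (i : Fin n) : Continuous fun x => w x i := hV.continuous_apply _
  have hx₀ : x₀ ∈ U := by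
    change LinearIndependent ℂ fun i => P x₀ (b i)
    simp only [hV.apply_coe]
    exact b.orthonormal.linearIndependent.map' (Submodule.subtype _) (Submodule.ker_subtype _)
  have hon : ∀ x ∈ U, Orthonormal ℂ fun i => e i x := fun x hx =>
    (InnerProductSpace.gramSchmidtNormed_orthonormal hx).codRestrict _ _
  exact ⟨e, U, hx₀, {
    isOpen := isOpen_setOfPred_linearIndependent.preimage (continuous_pi hw)
    continuousOn := continuousOn_gramSchmidtNormed (fun i => (hw i).continuousOn) fun _ hx => hx
    orthonormal := hon
    top_le_span := fun x hx => ((hon x hx).linearIndependent.span_eq_top_of_card_eq_finrank'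
      (by rw [hn, Fintype.card_fin])).ge }⟩

theorem isHilbertBundle [T2Space X] (hV : IsSubspaceBundle (EuclideanSpace ℂ (Fin n)) V P)
    [∀ x, FiniteDimensional ℂ (V x)] (hn : ∀ x, Module.finrank ℂ (V x) = n) :
    IsHilbertBundle (EuclideanSpace ℂ (Fin n)) fun x => V x where
  toIsBanachBundle :=
    have (x : X) : CompleteSpace (V x) := FiniteDimensional.complete ℂ _
    hV.isBanachBundle
  exists_trivialization x := by
    obtain ⟨e, U, hx, he⟩ := hV.exists_isOrthonormalFrame hn x
    exact ⟨he.trivialization hV, hx, fun y hy =>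
      ⟨(he.basis hy).repr, fun v => (he.basis_repr hy v).symm⟩⟩

end IsSubspaceBundle

end OrthonormalFrame

section Tautological

variable {d n : ℕ}

instance (P : coinvariantGrassmannian d n) : FiniteDimensional ℂ (TautologicalFibre P) :=
  Module.finite_of_rank_eq_nat P.2.2.2.2

theorem finrank_tautologicalFibre (P : coinvariantGrassmannian d n) :
    Module.finrank ℂ (TautologicalFibre P) = n :=
  Module.finrank_eq_of_rank_eq P.2.2.2.2

theorem continuous_coinvariantGrassmannian_apply (h : DruryArveson d) :
    Continuous fun P : coinvariantGrassmannian d n => P.1 h :=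
  continuous_subtype_val.clm_apply continuous_const

theorem isHilbertBundle_tautologicalBundle :
    IsHilbertBundle (EuclideanSpace ℂ (Fin n)) (tautologicalBundle d n) := by
  have hsub : IsSubspaceBundle (EuclideanSpace ℂ (Fin n)) (fun P : coinvariantGrassmannian d n =>
      LinearMap.range (P.1 : DruryArveson d →ₗ[ℂ] DruryArveson d)) Subtype.val :=
    ⟨⟨rfl⟩, continuous_coinvariantGrassmannian_apply, fun _ h => ⟨h, rfl⟩, proj_apply_fibre⟩
  exact hsub.isHilbertBundle finrank_tautologicalFibre

end Tautological

/-! ### Norms of matrices of operators -/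

section MatrixOperator

theorem norm_piLp_le_norm_piLp {ι V W : Type*} [Fintype ι] [NormedAddCommGroup V]
    [NormedAddCommGroup W] {x : PiLp 2 fun _ : ι => V} {y : PiLp 2 fun _ : ι => W}
    (h : ∀ i, ‖x i‖ ≤ ‖y i‖) : ‖x‖ ≤ ‖y‖ := by
  rw [PiLp.norm_eq_of_L2, PiLp.norm_eq_of_L2]
  gcongr with i
  exact h i

theorem norm_sq_toLp_append {m k : ℕ} {V : Type*} [NormedAddCommGroup V] (y : Fin m → V)
    (z : Fin k → V) :
    ‖(WithLp.toLp 2 (Fin.append y z) : PiLp 2 fun _ : Fin (m + k) => V)‖ ^ 2 =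
      ‖(WithLp.toLp 2 y : PiLp 2 fun _ : Fin m => V)‖ ^ 2 +
        ‖(WithLp.toLp 2 z : PiLp 2 fun _ : Fin k => V)‖ ^ 2 := by
  simp only [PiLp.norm_sq_eq_of_L2, Fin.sum_univ_add, Fin.append_left, Fin.append_right]

variable {m k : ℕ} {V W : Type*} [NormedAddCommGroup V] [InnerProductSpace ℂ V]
  [NormedAddCommGroup W] [InnerProductSpace ℂ W]

/-- A shortcut: the search for this instance is too slow for its default limit. -/
noncomputable local instance : SeminormedAddCommGroup
    ((PiLp 2 fun _ : Fin m => V) →L[ℂ] PiLp 2 fun _ : Fin m => V) :=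
  ContinuousLinearMap.toSeminormedAddCommGroup

theorem matrixOperator_apply (A : Matrix (Fin m) (Fin m) (V →L[ℂ] V))
    (x : PiLp 2 fun _ : Fin m => V) (i : Fin m) :
    matrixOperator m V A x i = ∑ j, A i j (x j) := by
  simp [matrixOperator]

theorem matrixOperator_single (A : Matrix (Fin m) (Fin m) (V →L[ℂ] V)) (j : Fin m) (v : V) :
    matrixOperator m V A (PiLp.single 2 j v) = WithLp.toLp 2 fun i => A i j v := by
  refine PiLp.ext fun i => ?_
  rw [matrixOperator_apply, Finset.sum_eq_single j (fun l _ hl => ?_) (by simp),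
    PiLp.single_eq_same]
  rw [PiLp.single_eq_of_ne 2 hl, map_zero]

theorem norm_entry_le_norm_matrixOperator (A : Matrix (Fin m) (Fin m) (V →L[ℂ] V))
    (i j : Fin m) : ‖A i j‖ ≤ ‖matrixOperator m V A‖ := by
  refine ContinuousLinearMap.opNorm_le_bound _ (norm_nonneg _) fun v => ?_
  calc ‖A i j v‖ ≤ ‖matrixOperator m V A (PiLp.single 2 j v)‖ := by
        rw [matrixOperator_single]
        exact PiLp.norm_apply_le (WithLp.toLp 2 fun i => A i j v : PiLp 2 fun _ : Fin m => V) i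
    _ ≤ ‖matrixOperator m V A‖ * ‖v‖ := by
        rw [← PiLp.norm_single 2 (fun _ : Fin m => V) j v]
        exact ContinuousLinearMap.le_opNorm _ _

theorem norm_matrixOperator_le_sum (A : Matrix (Fin m) (Fin m) (V →L[ℂ] V)) :
    ‖matrixOperator m V A‖ ≤ ∑ i, ∑ j, ‖A i j‖ := by
  refine ContinuousLinearMap.opNorm_le_bound _ (by positivity) fun x => ?_
  have hsum : matrixOperator m V A x = ∑ i, ∑ j, PiLp.single 2 i (A i j (x j)) := by
    ext i
    simp [matrixOperator_apply, Pi.single_apply]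
  rw [hsum, Finset.sum_mul]
  refine norm_sum_le_of_le _ fun i _ => ?_
  rw [Finset.sum_mul]
  refine norm_sum_le_of_le _ fun j _ => ?_
  rw [PiLp.norm_single]
  exact (A i j).le_opNorm_of_le (PiLp.norm_apply_le x j)

theorem matrixOperator_injective : Function.Injective (matrixOperator m V) := by
  refine (injective_iff_map_eq_zero _).2 fun A hA => ?_
  ext1 i j
  have h := norm_entry_le_norm_matrixOperator A i j
  rw [hA, norm_zero] at h
  exact norm_le_zero_iff.1 h

theorem continuous_matrixOperator : Continuous (matrixOperator m V) := by
  refine continuous_iff_continuousAt.2 fun A => tendsto_iff_norm_sub_tendsto_zero.2 ?_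
  have hentries : Continuous fun B : Matrix (Fin m) (Fin m) (V →L[ℂ] V) =>
      ∑ i, ∑ j, ‖B i j - A i j‖ := by
    fun_prop
  refine squeeze_zero (fun _ => norm_nonneg _) (fun B => ?_)
    (by simpa using hentries.tendsto A)
  rw [← map_sub]
  exact norm_matrixOperator_le_sum (B - A)

theorem norm_matrixOperator_one (a : V →L[ℂ] V) :
    ‖matrixOperator 1 V (Matrix.of fun _ _ => a)‖ = ‖a‖ :=
  le_antisymm (by simpa using norm_matrixOperator_le_sum (Matrix.of fun _ _ : Fin 1 => a))
    (norm_entry_le_norm_matrixOperator (Matrix.of fun _ _ : Fin 1 => a) 0 0)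

theorem norm_matrixOperator_map_comp_le {J : V →L[ℂ] W} {Q : W →L[ℂ] V}
    (hJ : ∀ v, ‖J v‖ ≤ ‖v‖) (hQ : ∀ w, ‖Q w‖ ≤ ‖w‖) (A : Matrix (Fin m) (Fin m) (W →L[ℂ] W)) :
    ‖matrixOperator m V (A.map fun a => Q ∘L a ∘L J)‖ ≤ ‖matrixOperator m W A‖ := by
  refine ContinuousLinearMap.opNorm_le_bound _ (norm_nonneg _) fun x => ?_
  calc _ ≤ ‖matrixOperator m W A (WithLp.toLp 2 fun j => J (x j))‖ :=
        norm_piLp_le_norm_piLp fun i => by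
          simpa [matrixOperator_apply] using hQ (∑ j, A i j (J (x j)))
    _ ≤ _ := ContinuousLinearMap.le_opNorm_of_le _ (norm_piLp_le_norm_piLp fun j => hJ (x j))

theorem norm_matrixOperator_map_comp {J : V →L[ℂ] W} {Q : W →L[ℂ] V} (hJ : ∀ v, ‖J v‖ ≤ ‖v‖)
    (hQ : ∀ w, ‖Q w‖ ≤ ‖w‖) (hQJ : ∀ v, Q (J v) = v)
    (A : Matrix (Fin m) (Fin m) (V →L[ℂ] V)) :
    ‖matrixOperator m W (A.map fun a => J ∘L a ∘L Q)‖ = ‖matrixOperator m V A‖ := by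
  refine le_antisymm (norm_matrixOperator_map_comp_le hQ hJ A) ?_
  have hA : A = (A.map fun a => J ∘L a ∘L Q).map fun b => Q ∘L b ∘L J := by
    ext i j v
    simp [hQJ]
  conv_lhs => rw [hA]
  exact norm_matrixOperator_map_comp_le hJ hQ _

theorem matrixOperator_fromBlocks_append (A : Matrix (Fin m) (Fin m) (V →L[ℂ] V))
    (B : Matrix (Fin k) (Fin k) (V →L[ℂ] V)) (y : Fin m → V) (z : Fin k → V) :
    matrixOperator (m + k) V
        (Matrix.reindex finSumFinEquiv finSumFinEquiv (Matrix.fromBlocks A 0 0 B))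
        (WithLp.toLp 2 (Fin.append y z)) =
      WithLp.toLp 2 (Fin.append (matrixOperator m V A (WithLp.toLp 2 y)).ofLp
        (matrixOperator k V B (WithLp.toLp 2 z)).ofLp) := by
  refine PiLp.ext fun i => ?_
  refine Fin.addCases (fun i => ?_) (fun i => ?_) i <;>
    simp [matrixOperator_apply, Fin.sum_univ_add]

theorem norm_matrixOperator_fromBlocks (A : Matrix (Fin m) (Fin m) (V →L[ℂ] V))
    (B : Matrix (Fin k) (Fin k) (V →L[ℂ] V)) :
    ‖matrixOperator (m + k) V
      (Matrix.reindex finSumFinEquiv finSumFinEquiv (Matrix.fromBlocks A 0 0 B))‖ =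
      max ‖matrixOperator m V A‖ ‖matrixOperator k V B‖ := by
  set T := matrixOperator (m + k) V
    (Matrix.reindex finSumFinEquiv finSumFinEquiv (Matrix.fromBlocks A 0 0 B))
  have hnorm : ∀ (y : Fin m → V) (z : Fin k → V), ‖T (WithLp.toLp 2 (Fin.append y z))‖ ^ 2 =
      ‖matrixOperator m V A (WithLp.toLp 2 y)‖ ^ 2 +
        ‖matrixOperator k V B (WithLp.toLp 2 z)‖ ^ 2 := fun y z => by
    rw [matrixOperator_fromBlocks_append, norm_sq_toLp_append]
  refine le_antisymm (ContinuousLinearMap.opNorm_le_bound _ (by positivity) fun x => ?_)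
    (max_le (ContinuousLinearMap.opNorm_le_bound _ (norm_nonneg _) fun y => ?_)
      (ContinuousLinearMap.opNorm_le_bound _ (norm_nonneg _) fun z => ?_))
  · obtain ⟨y, z, rfl⟩ : ∃ (y : Fin m → V) (z : Fin k → V), x = WithLp.toLp 2 (Fin.append y z) :=
      ⟨_, _, congrArg (WithLp.toLp 2) (Fin.append_castAdd_natAdd (f := x.ofLp)).symm⟩
    rw [← sq_le_sq₀ (norm_nonneg _) (by positivity), hnorm, mul_pow, norm_sq_toLp_append,
      mul_add, ← mul_pow, ← mul_pow]
    gcongr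
    · exact (matrixOperator _ V _).le_of_opNorm_le (le_max_left _ _) _
    · exact (matrixOperator _ V _).le_of_opNorm_le (le_max_right _ _) _
  · calc ‖matrixOperator m V A y‖ ≤ ‖T (WithLp.toLp 2 (Fin.append y.ofLp 0))‖ := by
          rw [← sq_le_sq₀ (norm_nonneg _) (norm_nonneg _), hnorm]
          exact le_add_of_nonneg_right (sq_nonneg _)
      _ ≤ _ := T.le_opNorm_of_le <| by
          simp [← sq_le_sq₀ (norm_nonneg _) (norm_nonneg _), norm_sq_toLp_append]
  · calc ‖matrixOperator k V B z‖ ≤ ‖T (WithLp.toLp 2 (Fin.append 0 z.ofLp))‖ := by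
          rw [← sq_le_sq₀ (norm_nonneg _) (norm_nonneg _), hnorm]
          exact le_add_of_nonneg_left (sq_nonneg _)
      _ ≤ _ := T.le_opNorm_of_le <| by
          simp [← sq_le_sq₀ (norm_nonneg _) (norm_nonneg _), norm_sq_toLp_append]

theorem norm_sq_toLp_eq_sum_inner {U : Submodule ℂ V} {b : ℕ} (e : OrthonormalBasis (Fin b) ℂ U)
    {y : Fin m → V} (hy : ∀ i, y i ∈ U) :
    ‖(WithLp.toLp 2 y : PiLp 2 fun _ : Fin m => V)‖ ^ 2 =
      ∑ l, ‖(WithLp.toLp 2 fun i => inner ℂ (e l : V) (y i) : EuclideanSpace ℂ (Fin m))‖ ^ 2 := by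
  simp only [PiLp.norm_sq_eq_of_L2]
  rw [Finset.sum_comm]
  exact Finset.sum_congr rfl fun i _ => (e.sum_sq_norm_inner_right ⟨y i, hy i⟩).symm

/-- In coordinates with respect to an orthonormal basis of a finite-dimensional subspace which
contains all the `x j`, the matrix `α` acts on each coordinate separately. -/
theorem norm_toLp_sum_smul_le (α : Matrix (Fin k) (Fin m) ℂ) (x : PiLp 2 fun _ : Fin m => V) :
    ‖(WithLp.toLp 2 fun i => ∑ j, α i j • x j : PiLp 2 fun _ : Fin k => V)‖ ≤
      ‖(Matrix.toEuclideanLin α).toContinuousLinearMap‖ * ‖x‖ := by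
  let U := Submodule.span ℂ (Set.range x.ofLp)
  have : FiniteDimensional ℂ U := FiniteDimensional.span_of_finite ℂ (Set.finite_range _)
  have hx : ∀ j, x j ∈ U := fun j => Submodule.subset_span ⟨j, rfl⟩
  have hαx : ∀ i, ∑ j, α i j • x j ∈ U := fun i =>
    U.sum_mem fun j _ => U.smul_mem (α i j) (hx j)
  let e := stdOrthonormalBasis ℂ U
  rw [← sq_le_sq₀ (norm_nonneg _) (by positivity), mul_pow, norm_sq_toLp_eq_sum_inner e hαx,
    (norm_sq_toLp_eq_sum_inner e hx : ‖x‖ ^ 2 = _), Finset.mul_sum]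
  refine Finset.sum_le_sum fun l _ => ?_
  rw [← mul_pow]
  gcongr
  calc _ = ‖(Matrix.toEuclideanLin α).toContinuousLinearMap
        (WithLp.toLp 2 fun j => inner ℂ (e l : V) (x j))‖ := by
        congr 1
        ext i
        simp [Matrix.toLpLin_apply, Matrix.mulVec, dotProduct]
    _ ≤ _ := ContinuousLinearMap.le_opNorm _ _

theorem matrixOperator_scalar_mul_apply (α : Matrix (Fin k) (Fin m) ℂ)
    (A : Matrix (Fin m) (Fin m) (V →L[ℂ] V)) (β : Matrix (Fin m) (Fin k) ℂ)
    (x : PiLp 2 fun _ : Fin k => V) :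
    matrixOperator k V (α.map (algebraMap ℂ (V →L[ℂ] V)) * A *
        β.map (algebraMap ℂ (V →L[ℂ] V))) x =
      WithLp.toLp 2 fun i => ∑ j, α i j •
        matrixOperator m V A (WithLp.toLp 2 fun i => ∑ j, β i j • x j) j := by
  ext i
  simp only [matrixOperator_apply, Matrix.mul_apply, Matrix.map_apply, sum_apply,
    mul_apply_eq_comp, ContinuousLinearMap.algebraMap_apply, map_sum, map_smul,
    Finset.smul_sum, Finset.sum_mul]
  rw [Finset.sum_comm_cycle]
  refine Finset.sum_congr rfl fun j _ => ?_
  rw [Finset.sum_comm]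
  exact Finset.sum_congr rfl fun l _ => Finset.sum_congr rfl fun p _ => smul_comm _ _ _

theorem norm_matrixOperator_scalar_mul_le (α : Matrix (Fin k) (Fin m) ℂ)
    (A : Matrix (Fin m) (Fin m) (V →L[ℂ] V)) (β : Matrix (Fin m) (Fin k) ℂ) :
    ‖matrixOperator k V (α.map (algebraMap ℂ (V →L[ℂ] V)) * A *
        β.map (algebraMap ℂ (V →L[ℂ] V)))‖ ≤
      ‖(Matrix.toEuclideanLin α).toContinuousLinearMap‖ * ‖matrixOperator m V A‖ *
        ‖(Matrix.toEuclideanLin β).toContinuousLinearMap‖ := by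
  refine ContinuousLinearMap.opNorm_le_bound _ (by positivity) fun x => ?_
  rw [matrixOperator_scalar_mul_apply, mul_assoc, mul_assoc]
  refine (norm_toLp_sum_smul_le α _).trans ?_
  gcongr
  exact ContinuousLinearMap.le_opNorm_of_le _ (norm_toLp_sum_smul_le β x)

end MatrixOperator

/-! ### Operator algebras of diagonal operators -/

section OperatorAlgebra

variable {A K : Type*} [Ring A] [Algebra ℂ A] [NormedAddCommGroup K] [InnerProductSpace ℂ K]

theorem exists_lim_of_isClosed_range [CompleteSpace K] {ρ : A →ₐ[ℂ] (K →L[ℂ] K)}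
    (hclosed : IsClosed (Set.range ρ)) {u : ℕ → A}
    (hu : ∀ ε > 0, ∃ k₀, ∀ k ≥ k₀, ∀ l ≥ k₀, ‖ρ (u k - u l)‖ < ε) :
    ∃ a, ∀ ε > 0, ∃ k₀, ∀ k ≥ k₀, ‖ρ (u k - a)‖ < ε := by
  simp only [map_sub, ← dist_eq_norm] at hu ⊢
  obtain ⟨T, hT⟩ := cauchySeq_tendsto_of_complete (Metric.cauchySeq_iff.2 hu)
  obtain ⟨a, rfl⟩ := hclosed.mem_of_tendsto hT (Eventually.of_forall fun k => ⟨u k, rfl⟩)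
  exact ⟨a, Metric.tendsto_atTop.1 hT⟩

theorem IsAbstractOperatorAlgebra.of_representation [CompleteSpace K] [Nontrivial K]
    {ρ : A →ₐ[ℂ] (K →L[ℂ] K)} (hρ : Function.Injective ρ) (hclosed : IsClosed (Set.range ρ)) :
    IsAbstractOperatorAlgebra A fun m X => ‖matrixOperator m K (X.map ρ)‖ where
  nonneg m X := norm_nonneg _
  eq_zero_iff m X := by
    rw [norm_eq_zero, map_eq_zero_iff _ matrixOperator_injective]
    exact map_eq_zero_iff ρ.mapMatrix (Matrix.map_injective hρ)
  add_le m X Y := by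
    rw [Matrix.map_add _ (map_add ρ), map_add]
    exact norm_add_le _ _
  smul_eq m c X := by
    rw [Matrix.map_smul _ _ (map_smul ρ c), map_smul]
    exact norm_smul c _
  complete u hu := by
    have hone : ∀ a : A, ‖matrixOperator 1 K ((Matrix.of fun _ _ => a).map ρ)‖ = ‖ρ a‖ :=
      fun a => norm_matrixOperator_one (ρ a)
    simp only [hone] at hu ⊢
    exact exists_lim_of_isClosed_range hclosed hu
  directSum m k X Y := by
    rw [← norm_matrixOperator_fromBlocks, Matrix.reindex_apply, Matrix.reindex_apply,
      ← Matrix.submatrix_map, Matrix.fromBlocks_map, Matrix.map_zero _ (map_zero ρ),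
      Matrix.map_zero _ (map_zero ρ)]
  scalar_mul_le m k α X β := by
    have hmap : ∀ {m k : ℕ} (α : Matrix (Fin m) (Fin k) ℂ), (α.map (algebraMap ℂ A)).map ρ =
        α.map (algebraMap ℂ (K →L[ℂ] K)) := fun α => by
      ext1 i j
      simp
    rw [Matrix.map_mul, Matrix.map_mul, hmap, hmap]
    exact norm_matrixOperator_scalar_mul_le α _ β
  mul_le m X Y := by
    rw [Matrix.map_mul, map_mul]
    exact norm_mul_le _ _
  one_eq := by
    have : Nontrivial (PiLp 2 fun _ : Fin 1 => K) := (WithLp.equiv 2 (Fin 1 → K)).nontrivial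
    rw [Matrix.map_one _ (map_zero ρ) (map_one ρ), map_one]
    exact norm_one

end OperatorAlgebra

section DiagonalOperator

/-- Two shortcuts: the search for these instances exceeds its default limit. -/
noncomputable local instance {m : ℕ} {V : Type*} [NormedAddCommGroup V] [InnerProductSpace ℂ V] :
    SeminormedAddCommGroup ((PiLp 2 fun _ : Fin m => V) →L[ℂ] PiLp 2 fun _ : Fin m => V) :=
  ContinuousLinearMap.toSeminormedAddCommGroup

theorem hasSum_norm_sq_piLp_lp {ι : Type*} {m : ℕ} {V : ι → Type*} [∀ p, NormedAddCommGroup (V p)]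
    (y : PiLp 2 fun _ : Fin m => lp V 2) :
    HasSum (fun p => ‖(WithLp.toLp 2 fun i => y i p : PiLp 2 fun _ : Fin m => V p)‖ ^ 2)
      (‖y‖ ^ 2) := by
  simp only [PiLp.norm_sq_eq_of_L2]
  refine hasSum_sum fun i _ => ?_
  simpa using lp.hasSum_norm (p := 2) (by norm_num) (y i)

variable {ι : Type*} {V : ι → Type*} [∀ p, NormedAddCommGroup (V p)]
  [∀ p, InnerProductSpace ℂ (V p)] {m : ℕ}

noncomputable local instance : SeminormedAddCommGroup (lp V 2 →L[ℂ] lp V 2) :=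
  ContinuousLinearMap.toSeminormedAddCommGroup

/-- The operator on the Hilbert sum of the spaces `V p` given by a bounded family of operators. -/
noncomputable def diagonalOperator (T : ∀ p, V p →L[ℂ] V p) (hT : IsBoundedSection T) :
    lp V 2 →L[ℂ] lp V 2 :=
  lp.mapCLM 2 T (le_max_right hT.choose 0) fun p => (hT.choose_spec p).trans (le_max_left _ _)

theorem diagonalOperator_apply (T : ∀ p, V p →L[ℂ] V p) (hT : IsBoundedSection T) (x : lp V 2)
    (p : ι) : diagonalOperator T hT x p = T p (x p) := rfl

open Classical in
/-- The diagonal block at `p` of an operator on the Hilbert sum of the spaces `V p`. -/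
noncomputable def diagonalBlock (S : lp V 2 →L[ℂ] lp V 2) (p : ι) : V p →L[ℂ] V p :=
  lp.evalCLM ℂ V 2 p ∘L S ∘L lp.singleContinuousLinearMap ℂ V 2 p

theorem diagonalBlock_diagonalOperator (T : ∀ p, V p →L[ℂ] V p) (hT : IsBoundedSection T) :
    diagonalBlock (diagonalOperator T hT) = T := by
  classical
  ext p v
  exact congrArg (T p) (lp.single_apply_self 2 p v)

theorem norm_matrixOperator_diagonalBlock_le
    (S : Matrix (Fin m) (Fin m) (lp V 2 →L[ℂ] lp V 2)) (p : ι) :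
    ‖matrixOperator m (V p) (S.map fun s => diagonalBlock s p)‖ ≤
      ‖matrixOperator m (lp V 2) S‖ := by
  classical
  exact norm_matrixOperator_map_comp_le (fun v => (lp.norm_single (by norm_num) p v).le)
    (fun x => lp.norm_apply_le_norm two_ne_zero x p) S

theorem norm_diagonalBlock_sub_le (S S' : lp V 2 →L[ℂ] lp V 2) (p : ι) :
    ‖diagonalBlock S p - diagonalBlock S' p‖ ≤ ‖S - S'‖ := by
  have hsub : diagonalBlock S p - diagonalBlock S' p = diagonalBlock (S - S') p := by
    simp only [diagonalBlock, ContinuousLinearMap.sub_comp, ContinuousLinearMap.comp_sub]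
  rw [hsub, ← norm_matrixOperator_one, ← norm_matrixOperator_one (S - S')]
  exact norm_matrixOperator_diagonalBlock_le (Matrix.of fun _ _ => S - S') p

theorem norm_matrixOperator_diagonalOperator_le {T : Fin m → Fin m → ∀ p, V p →L[ℂ] V p}
    (hT : ∀ i j, IsBoundedSection (T i j)) {C : ℝ} (hC : 0 ≤ C)
    (h : ∀ p, ‖matrixOperator m (V p) (Matrix.of fun i j => T i j p)‖ ≤ C) :
    ‖matrixOperator m (lp V 2) (Matrix.of fun i j => diagonalOperator (T i j) (hT i j))‖ ≤ C := by
  refine ContinuousLinearMap.opNorm_le_bound _ hC fun x => ?_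
  rw [← sq_le_sq₀ (norm_nonneg _) (by positivity), mul_pow]
  refine hasSum_le (fun p => ?_) (hasSum_norm_sq_piLp_lp _)
    ((hasSum_norm_sq_piLp_lp x).mul_left (C ^ 2))
  rw [← mul_pow]
  gcongr
  refine le_trans (le_of_eq ?_) ((matrixOperator m (V p) _).le_of_opNorm_le (h p)
    (WithLp.toLp 2 fun j => x j p))
  congr 1
  ext i
  simp only [matrixOperator_apply, Matrix.of_apply, lp.coeFn_sum]
  exact Finset.sum_apply p _ _

theorem norm_matrixOperator_diagonalOperator {T : Fin m → Fin m → ∀ p, V p →L[ℂ] V p}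
    (hT : ∀ i j, IsBoundedSection (T i j)) :
    ‖matrixOperator m (lp V 2) (Matrix.of fun i j => diagonalOperator (T i j) (hT i j))‖ =
      ⨆ p, ‖matrixOperator m (V p) (Matrix.of fun i j => T i j p)‖ := by
  set D := Matrix.of fun i j => diagonalOperator (T i j) (hT i j)
  have hle : ∀ p, ‖matrixOperator m (V p) (Matrix.of fun i j => T i j p)‖ ≤
      ‖matrixOperator m (lp V 2) D‖ := fun p => by
    have hblock : (Matrix.of fun i j => T i j p) = D.map fun S => diagonalBlock S p := by
      ext1 i j
      simp [D, diagonalBlock_diagonalOperator]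
    rw [hblock]
    exact norm_matrixOperator_diagonalBlock_le D p
  refine le_antisymm ?_ (Real.iSup_le hle (norm_nonneg _))
  exact norm_matrixOperator_diagonalOperator_le hT (Real.iSup_nonneg fun _ => norm_nonneg _)
    (le_ciSup ⟨_, Set.forall_mem_range.2 hle⟩)

variable {A : Type*} [Ring A] [Algebra ℂ A]

/-- The representation by diagonal operators of an algebra of bounded families of operators. -/
noncomputable def diagonalRepresentation (φ : A →ₐ[ℂ] ∀ p, V p →L[ℂ] V p)
    (hφ : ∀ a, IsBoundedSection (φ a)) : A →ₐ[ℂ] (lp V 2 →L[ℂ] lp V 2) where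
  toFun a := diagonalOperator (φ a) (hφ a)
  map_one' := by
    ext x p
    simp [diagonalOperator_apply]
  map_mul' a b := by
    ext x p
    simp [diagonalOperator_apply]
  map_zero' := by
    ext x p
    simp [diagonalOperator_apply]
  map_add' a b := by
    ext x p
    simp [diagonalOperator_apply]
  commutes' c := by
    ext x p
    simp [diagonalOperator_apply]

variable {φ : A →ₐ[ℂ] ∀ p, V p →L[ℂ] V p} (hφ : ∀ a, IsBoundedSection (φ a))

theorem diagonalBlock_diagonalRepresentation (a : A) :
    diagonalBlock (diagonalRepresentation φ hφ a) = φ a :=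
  diagonalBlock_diagonalOperator (φ a) (hφ a)

theorem diagonalRepresentation_injective (hinj : Function.Injective φ) :
    Function.Injective (diagonalRepresentation φ hφ) := fun a b hab => hinj <| by
  rw [← diagonalBlock_diagonalRepresentation hφ, hab, diagonalBlock_diagonalRepresentation]

theorem norm_diagonalRepresentation_le {a : A} {C : ℝ} (hC : 0 ≤ C) (h : ∀ p, ‖φ a p‖ ≤ C) :
    ‖diagonalRepresentation φ hφ a‖ ≤ C := by
  rw [← norm_matrixOperator_one]
  refine norm_matrixOperator_diagonalOperator_le (T := fun _ _ => φ a) (fun _ _ => hφ a) hC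
    fun p => ?_
  exact (norm_matrixOperator_one (φ a p)).trans_le (h p)

/-- A limit of diagonal operators is approximated by the diagonal operator of its diagonal
blocks. -/
theorem isClosed_range_diagonalRepresentation
    (hlim : ∀ T : ∀ p, V p →L[ℂ] V p, (∀ ε > 0, ∃ a, ∀ p, ‖φ a p - T p‖ ≤ ε) →
      T ∈ Set.range φ) : IsClosed (Set.range (diagonalRepresentation φ hφ)) := by
  refine isClosed_of_closure_subset fun S hS => ?_
  replace hS : ∀ ε > 0, ∃ a, dist S (diagonalRepresentation φ hφ a) < ε :=
    Metric.mem_closure_range_iff.1 hS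
  have happrox : ∀ a p, ‖φ a p - diagonalBlock S p‖ ≤ dist S (diagonalRepresentation φ hφ a) :=
    fun a p => by
      rw [← diagonalBlock_diagonalRepresentation hφ, dist_eq_norm']
      exact norm_diagonalBlock_sub_le _ S p
  obtain ⟨b, hb⟩ := hlim (diagonalBlock S) fun ε hε => by
    obtain ⟨a, ha⟩ := hS ε hε
    exact ⟨a, fun p => (happrox a p).trans ha.le⟩
  refine ⟨b, eq_of_forall_dist_le fun ε hε => ?_⟩
  obtain ⟨a, ha⟩ := hS (ε / 2) (half_pos hε)
  have hab : ‖diagonalRepresentation φ hφ (a - b)‖ ≤ dist S (diagonalRepresentation φ hφ a) :=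
    norm_diagonalRepresentation_le hφ dist_nonneg fun p => by
      rw [map_sub, Pi.sub_apply, hb]
      exact happrox a p
  rw [map_sub, ← dist_eq_norm] at hab
  linarith [dist_triangle_left (diagonalRepresentation φ hφ b) S (diagonalRepresentation φ hφ a),
    dist_comm S (diagonalRepresentation φ hφ a)]

end DiagonalOperator

/-! ### Spans of kernel functions -/

section KernelSpan

theorem eq_zero_of_sum_mul_inv_sub_eq_zero {K ι : Type*} [Field K] {s : Finset ι} {t c : ι → K}
    (ht : Set.InjOn t s) {S : Set K} (hS : S.Infinite)
    (h : ∀ x ∈ S, ∑ i ∈ s, c i * (x - t i)⁻¹ = 0) {i : ι} (hi : i ∈ s) : c i = 0 := by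
  classical
  have hweight : ∀ j ∈ s, Lagrange.nodalWeight s t j ≠ 0 := fun j hj =>
    Lagrange.nodalWeight_ne_zero ht hj
  let p := Lagrange.interpolate s t fun j => c j / Lagrange.nodalWeight s t j
  have hp : p = 0 := by
    refine Polynomial.eq_zero_of_infinite_isRoot p
      ((hS.sdiff (s.image t).finite_toSet).mono fun x hx => ?_)
    have hxt : ∀ j ∈ s, x ≠ t j := fun j hj hxj =>
      hx.2 (Finset.mem_coe.2 (hxj ▸ Finset.mem_image_of_mem t hj))
    rw [Set.mem_ofPred_eq, Polynomial.IsRoot, Lagrange.eval_interpolate_not_at_node _ hxt,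
      ← mul_zero (Polynomial.eval x _), ← h x hx.1]
    refine congrArg _ (Finset.sum_congr rfl fun j hj => ?_)
    rw [mul_right_comm, mul_div_cancel₀ _ (hweight j hj)]
  have hpi : c i / Lagrange.nodalWeight s t i = 0 := by
    rw [← Lagrange.eval_interpolate_at_node (fun j => c j / Lagrange.nodalWeight s t j) ht hi]
    exact congrArg (Polynomial.eval (t i)) hp |>.trans Polynomial.eval_zero
  exact (div_eq_zero_iff.1 hpi).resolve_right (hweight i hi)

theorem adjoint_apply_kerFun_of_apply_eq_mul {𝕜 H X : Type*} [RCLike 𝕜] [NormedAddCommGroup H]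
    [InnerProductSpace 𝕜 H] [CompleteSpace H] [RKHS 𝕜 H X 𝕜] {T : H →L[𝕜] H} {φ : X → 𝕜}
    (hT : ∀ h x, T h x = φ x * h x) (x : X) (a : 𝕜) :
    ContinuousLinearMap.adjoint T (RKHS.kerFun H x a) =
      starRingEnd 𝕜 (φ x) • RKHS.kerFun H x a := by
  refine ext_inner_right 𝕜 fun h => ?_
  rw [ContinuousLinearMap.adjoint_inner_left, inner_smul_left, RKHS.kerFun_inner,
    RKHS.kerFun_inner, hT, starRingEnd_self_apply, ← smul_eq_mul, inner_smul_right]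

variable {d : ℕ}

/-- The point `s e₁` of the unit ball of `ℂ^d`. -/
noncomputable def axisPoint (hd : 0 < d) (s : Metric.ball (0 : ℂ) 1) : unitBall d :=
  ⟨EuclideanSpace.single ⟨0, hd⟩ (s : ℂ), by simpa using mem_ball_zero_iff.1 s.2⟩

theorem kerFun_axisPoint_apply (hd : 0 < d) (t s : Metric.ball (0 : ℂ) 1) :
    RKHS.kerFun (DruryArveson d) (axisPoint hd t) (1 : ℂ) (axisPoint hd s) =
      (1 - starRingEnd ℂ (t : ℂ) * s)⁻¹ := by
  rw [RKHS.kerFun_apply, DruryArveson.kernel_eq]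
  simp [druryArvesonKernel, axisPoint, EuclideanSpace.inner_single_left]

theorem linearIndependent_kerFun_axisPoint (hd : 0 < d) : LinearIndependent ℂ
    fun t => RKHS.kerFun (DruryArveson d) (axisPoint hd t) (1 : ℂ) := by
  refine linearIndependent_iff'.2 fun s c hc i hi => ?_
  refine eq_zero_of_sum_mul_inv_sub_eq_zero (S := (Metric.closedBall 0 1)ᶜ)
    (t := fun t : Metric.ball (0 : ℂ) 1 => starRingEnd ℂ (t : ℂ))
    ((star_injective.comp Subtype.val_injective).injOn) ?_ (fun x hx => ?_) hi
  · exact infinite_of_mem_nhds 2 (Metric.isClosed_closedBall.isOpen_compl.mem_nhds (by norm_num))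
  · have hx1 : 1 < ‖x‖ := by simpa using hx
    have hx0 : x ≠ 0 := norm_pos_iff.1 (one_pos.trans hx1)
    let y : Metric.ball (0 : ℂ) 1 := ⟨x⁻¹, by simpa using inv_lt_one_of_one_lt₀ hx1⟩
    have hker : ∀ t : Metric.ball (0 : ℂ) 1,
        RKHS.kerFun (DruryArveson d) (axisPoint hd t) (1 : ℂ) (axisPoint hd y) =
          x * (x - starRingEnd ℂ (t : ℂ))⁻¹ := fun t => by
      rw [kerFun_axisPoint_apply, ← inv_inj, mul_inv, inv_inv, inv_inv]
      field
    have heval := congrArg (fun f => RKHS.coeCLM ℂ f (axisPoint hd y)) hc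
    simp only [map_sum, map_smul, map_zero, RKHS.coeCLM_apply, Finset.sum_apply, Pi.smul_apply,
      Pi.zero_apply, hker, smul_eq_mul, mul_left_comm _ x, ← Finset.mul_sum] at heval
    exact (mul_eq_zero.1 heval).resolve_left hx0

theorem starProjection_mem_coinvariantGrassmannian {U : Submodule ℂ (DruryArveson d)}
    [FiniteDimensional ℂ U]
    (hU : ∀ T ∈ multiplierAlgebra d, ∀ v ∈ U, ContinuousLinearMap.adjoint T v ∈ U) :
    U.starProjection ∈ coinvariantGrassmannian d (Module.finrank ℂ U) := by
  have hstar := isStarProjection_starProjection (U := U)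
  refine ⟨hstar.isIdempotentElem, hstar.isSelfAdjoint, fun T hT => ?_, ?_⟩
  · ext1 h
    exact Submodule.starProjection_eq_self_iff.2 (hU T hT _ (U.starProjection_apply_mem h))
  · rw [Submodule.range_starProjection, Module.finrank_eq_rank]

theorem nonempty_coinvariantGrassmannian (hd : 0 < d) (n : ℕ) :
    Nonempty (coinvariantGrassmannian d n) := by
  have : Infinite (Metric.ball (0 : ℂ) 1) :=
    (infinite_of_mem_nhds 0 (Metric.ball_mem_nhds 0 one_pos)).to_subtype
  let t : Fin n ↪ Metric.ball (0 : ℂ) 1 := Fin.valEmbedding.trans (Infinite.natEmbedding _)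
  let k i := RKHS.kerFun (DruryArveson d) (axisPoint hd (t i)) (1 : ℂ)
  have hk : LinearIndependent ℂ k := (linearIndependent_kerFun_axisPoint hd).comp t t.injective
  have : FiniteDimensional ℂ (Submodule.span ℂ (Set.range k)) :=
    FiniteDimensional.span_of_finite ℂ (Set.finite_range k)
  have hmem := starProjection_mem_coinvariantGrassmannian (U := Submodule.span ℂ (Set.range k))
    fun T ⟨φ, hφ⟩ => by
      refine (Submodule.span_le (p := (Submodule.span ℂ (Set.range k)).comap _)).2
        (Set.range_subset_iff.2 fun i => ?_)
      rw [SetLike.mem_coe, Submodule.mem_comap, ContinuousLinearMap.coe_coe,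
        adjoint_apply_kerFun_of_apply_eq_mul hφ]
      exact Submodule.smul_mem _ _ (Submodule.subset_span ⟨i, rfl⟩)
  rw [finrank_span_eq_card hk, Fintype.card_fin] at hmem
  exact ⟨_, hmem⟩

end KernelSpan

/-! ### The bundles of compressed multipliers -/

section MultiplierBundle

variable {d n m : ℕ}

theorem norm_coinvariantGrassmannian_apply_le (P : coinvariantGrassmannian d n)
    (h : DruryArveson d) : ‖P.1 h‖ ≤ ‖h‖ := by
  have hP : IsStarProjection P.1 := ⟨P.2.1, P.2.2.1⟩
  simpa using P.1.le_of_opNorm_le hP.norm_le h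

theorem norm_compression_le (P : coinvariantGrassmannian d n)
    (T : DruryArveson d →L[ℂ] DruryArveson d) : ‖compression P T‖ ≤ ‖T‖ :=
  ContinuousLinearMap.opNorm_le_bound _ (norm_nonneg _) fun _ =>
    (norm_coinvariantGrassmannian_apply_le P _).trans (T.le_opNorm _)

theorem norm_matrixOperator_compression (P : coinvariantGrassmannian d n)
    (T : Matrix (Fin m) (Fin m) (DruryArveson d →L[ℂ] DruryArveson d)) :
    ‖matrixOperator m (TautologicalFibre P) (T.map (compression P))‖ =
      ‖matrixOperator m (DruryArveson d) (T.map fun t => P.1 ∘L t ∘L P.1)‖ :=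
  (norm_matrixOperator_map_comp
    (J := (LinearMap.range (P.1 : DruryArveson d →ₗ[ℂ] DruryArveson d)).subtypeL)
    (Q := P.1.codRestrict _ fun h => ⟨h, rfl⟩) (fun _ => le_rfl)
    (norm_coinvariantGrassmannian_apply_le P) (fun v => Subtype.ext (proj_apply_fibre P v))
    (T.map (compression P))).symm

theorem continuous_norm_matrixOperator_compression
    (T : Matrix (Fin m) (Fin m) (DruryArveson d →L[ℂ] DruryArveson d)) :
    Continuous fun P : coinvariantGrassmannian d n =>
      ‖matrixOperator m (TautologicalFibre P) (T.map (compression P))‖ := by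
  simp only [norm_matrixOperator_compression]
  refine (continuous_matrixOperator.comp (continuous_pi fun i => continuous_pi fun j => ?_)).norm
  exact continuous_subtype_val.clm_comp (continuous_const.clm_comp continuous_subtype_val)

theorem continuous_norm_compression (T : DruryArveson d →L[ℂ] DruryArveson d) :
    Continuous fun P : coinvariantGrassmannian d n => ‖compression P T‖ :=
  (continuous_norm_matrixOperator_compression (Matrix.of fun _ _ : Fin 1 => T)).congr fun P =>
    norm_matrixOperator_one (compression P T)

/-- The inclusion of the fibre `P 𝓜_d|_{P H²_d}` into the operators on `P H²_d`. -/
noncomputable def MultiplierFibre.toOperator (P : coinvariantGrassmannian d n) :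
    MultiplierFibre P →ₐ[ℂ] (TautologicalFibre P →L[ℂ] TautologicalFibre P) :=
  (compressionHom P).range.val

/-- The inclusion of the fibre `(I_m ⊗ P) M_m(𝓜_d)|_{ℂ^m ⊗ P H²_d}` into the operators on
`(P H²_d)^m`. -/
noncomputable def AmplifiedFibre.toOperator (m : ℕ) (P : coinvariantGrassmannian d n) :
    AmplifiedFibre m P →ₐ[ℂ] (PiLp 2 (fun _ : Fin m => TautologicalFibre P) →L[ℂ]
      PiLp 2 (fun _ : Fin m => TautologicalFibre P)) :=
  ((matrixOperator m (TautologicalFibre P)).comp (compressionHom P).mapMatrix).range.val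

theorem MultiplierFibre.toOperator_injective (P : coinvariantGrassmannian d n) :
    Function.Injective (toOperator P) := Subtype.val_injective

theorem AmplifiedFibre.toOperator_injective (P : coinvariantGrassmannian d n) :
    Function.Injective (toOperator m P) := Subtype.val_injective

theorem AmplifiedFibre.toOperator_matrixSection
    (X : Matrix (Fin m) (Fin m) (∀ P, multiplierBundle d n P)) (P : coinvariantGrassmannian d n) :
    toOperator m P (matrixSection X P) = matrixOperator m (TautologicalFibre P)
      (X.map fun s => MultiplierFibre.toOperator P (s P)) := rfl

instance (P : coinvariantGrassmannian d n) : FiniteDimensional ℂ (MultiplierFibre P) :=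
  Module.Finite.of_injective (MultiplierFibre.toOperator P).toLinearMap
    (MultiplierFibre.toOperator_injective P)

instance (P : coinvariantGrassmannian d n) : FiniteDimensional ℂ (AmplifiedFibre m P) :=
  Module.Finite.of_injective (AmplifiedFibre.toOperator m P).toLinearMap
    (AmplifiedFibre.toOperator_injective P)

instance (P : coinvariantGrassmannian d n) : CompleteSpace (MultiplierFibre P) :=
  FiniteDimensional.complete ℂ _

instance (P : coinvariantGrassmannian d n) : CompleteSpace (AmplifiedFibre m P) :=
  FiniteDimensional.complete ℂ _

/-- The sections `γ_f` as a unital homomorphism from the multiplier algebra. -/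
noncomputable def multiplierSectionHom (d n : ℕ) :
    multiplierAlgebra d →ₐ[ℂ] ∀ P, multiplierBundle d n P :=
  AlgHom.pi fun P => (compressionHom P).rangeRestrict

/-- The sections of `M_m(𝔐_{d,n})` given by matrices of multipliers, as a unital homomorphism. -/
noncomputable def amplifiedMultiplierSectionHom (m d n : ℕ) :
    Matrix (Fin m) (Fin m) (multiplierAlgebra d) →ₐ[ℂ] ∀ P, amplifiedBundle m d n P :=
  AlgHom.pi fun P =>
    ((matrixOperator m (TautologicalFibre P)).comp (compressionHom P).mapMatrix).rangeRestrict

theorem isFellFamily_multiplierSectionHom (d n : ℕ) :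
    IsFellFamily Unit (multiplierSectionHom d n).toLinearMap where
  surjective P := (compressionHom P).rangeRestrict_surjective
  continuous_norm f := continuous_norm_compression f.1
  eq_tubeTopology := rfl

theorem isFellFamily_amplifiedMultiplierSectionHom (m d n : ℕ) :
    IsFellFamily Unit (amplifiedMultiplierSectionHom m d n).toLinearMap where
  surjective P := ((matrixOperator m (TautologicalFibre P)).comp
    (compressionHom P).mapMatrix).rangeRestrict_surjective
  continuous_norm f := continuous_norm_matrixOperator_compression (f.map Subtype.val)
  eq_tubeTopology := rfl

theorem isBanachAlgebraBundle_multiplierBundle (d n : ℕ) :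
    IsBanachAlgebraBundle Unit (multiplierBundle d n) :=
  (isFellFamily_multiplierSectionHom d n).isBanachAlgebraBundle

theorem isBanachAlgebraBundle_amplifiedBundle (m d n : ℕ) :
    IsBanachAlgebraBundle Unit (amplifiedBundle m d n) :=
  (isFellFamily_amplifiedMultiplierSectionHom m d n).isBanachAlgebraBundle

theorem isContinuousSection_multiplierSection (f : multiplierAlgebra d) :
    IsContinuousSection Unit (multiplierBundle d n) (multiplierSection n f) :=
  (isFellFamily_multiplierSectionHom d n).isContinuousSection f

theorem isContinuousSection_amplifiedMultiplierSection
    (f : Matrix (Fin m) (Fin m) (multiplierAlgebra d)) :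
    IsContinuousSection Unit (amplifiedBundle m d n) (amplifiedMultiplierSection n f) :=
  (isFellFamily_amplifiedMultiplierSectionHom m d n).isContinuousSection f

theorem isBoundedSection_multiplierSection (f : multiplierAlgebra d) :
    IsBoundedSection (multiplierSection n f) :=
  ⟨‖f‖, fun P => norm_compression_le P f.1⟩

end MultiplierBundle

section MatrixSection

variable {d n m : ℕ} {X : Matrix (Fin m) (Fin m) (∀ P, multiplierBundle d n P)}

theorem exists_eq_matrixSection (Y : ∀ P, amplifiedBundle m d n P) :
    ∃ X : Matrix (Fin m) (Fin m) (∀ P, multiplierBundle d n P), Y = matrixSection X := by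
  choose f hf using fun P => (Y P).2
  exact ⟨Matrix.of fun i j P => multiplierSection n (f P i j) P,
    funext fun P => AmplifiedFibre.toOperator_injective P (hf P).symm⟩

theorem matrixSection_sub (X Y : Matrix (Fin m) (Fin m) (∀ P, multiplierBundle d n P)) :
    matrixSection (X - Y) = matrixSection X - matrixSection Y := by
  refine funext fun P => AmplifiedFibre.toOperator_injective P ?_
  rw [Pi.sub_apply, map_sub]
  simp only [AmplifiedFibre.toOperator_matrixSection]
  rw [← map_sub]
  refine congrArg _ (Matrix.ext fun i j => ?_)
  exact map_sub (MultiplierFibre.toOperator P) _ _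

theorem norm_le_norm_matrixSection (X : Matrix (Fin m) (Fin m) (∀ P, multiplierBundle d n P))
    (P : coinvariantGrassmannian d n) (i j : Fin m) : ‖X i j P‖ ≤ ‖matrixSection X P‖ :=
  norm_entry_le_norm_matrixOperator (X.map fun s => MultiplierFibre.toOperator P (s P)) i j

theorem norm_matrixSection_le_sum (X : Matrix (Fin m) (Fin m) (∀ P, multiplierBundle d n P))
    (P : coinvariantGrassmannian d n) : ‖matrixSection X P‖ ≤ ∑ i, ∑ j, ‖X i j P‖ :=
  norm_matrixOperator_le_sum (X.map fun s => MultiplierFibre.toOperator P (s P))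

theorem norm_matrixSection_one (s : ∀ P, multiplierBundle d n P) (P : coinvariantGrassmannian d n) :
    ‖matrixSection (Matrix.of fun _ _ : Fin 1 => s) P‖ = ‖s P‖ :=
  norm_matrixOperator_one (MultiplierFibre.toOperator P (s P))

theorem tendsto_norm_matrixSection_iff {l : Filter (coinvariantGrassmannian d n)} :
    Tendsto (fun P => ‖matrixSection X P‖) l (𝓝 0) ↔
      ∀ i j, Tendsto (fun P => ‖X i j P‖) l (𝓝 0) := by
  refine ⟨fun h i j => squeeze_zero (fun _ => norm_nonneg _)
    (fun P => norm_le_norm_matrixSection X P i j) h, fun h => ?_⟩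
  refine squeeze_zero (fun _ => norm_nonneg _) (norm_matrixSection_le_sum X) ?_
  simpa using tendsto_finsetSum Finset.univ fun i _ =>
    tendsto_finsetSum Finset.univ fun j _ => h i j

theorem continuousAt_matrixSection_iff {P : coinvariantGrassmannian d n} :
    ContinuousAt (fun Q => (⟨Q, matrixSection X Q⟩ : TotalSpace Unit (amplifiedBundle m d n))) P ↔
      ∀ i j, ContinuousAt
        (fun Q => (⟨Q, X i j Q⟩ : TotalSpace Unit (multiplierBundle d n))) P := by
  choose f hf using fun i j => (isFellFamily_multiplierSectionHom d n).surjective P (X i j P)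
  have hfP : amplifiedMultiplierSection n (Matrix.of f) P = matrixSection X P :=
    AmplifiedFibre.toOperator_injective P (congrArg (matrixOperator m _)
      (Matrix.ext fun i j => congrArg (MultiplierFibre.toOperator P) (hf i j)))
  have hentry : ∀ i j, ContinuousAt
      (fun Q => (⟨Q, X i j Q⟩ : TotalSpace Unit (multiplierBundle d n))) P ↔
        Tendsto (fun Q => ‖X i j Q - multiplierSection n (f i j) Q‖) (𝓝 P) (𝓝 0) := fun i j =>
    (isBanachAlgebraBundle_multiplierBundle d n).continuousAt_section_iff
      (isContinuousSection_multiplierSection (f i j)) (hf i j)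
  rw [(isBanachAlgebraBundle_amplifiedBundle m d n).continuousAt_section_iff
    (isContinuousSection_amplifiedMultiplierSection (Matrix.of f)) hfP]
  simp only [hentry]
  have hsub := tendsto_norm_matrixSection_iff (l := 𝓝 P)
    (X := X - (Matrix.of f).map (multiplierSection n))
  rw [matrixSection_sub] at hsub
  exact hsub

theorem isContinuousSection_matrixSection_iff :
    IsContinuousSection Unit (amplifiedBundle m d n) (matrixSection X) ↔
      ∀ i j, IsContinuousSection Unit (multiplierBundle d n) (X i j) := by
  simp only [IsContinuousSection, continuous_iff_continuousAt, continuousAt_matrixSection_iff]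
  exact ⟨fun h i j P => h P i j, fun h P i j => h i j P⟩

theorem isBoundedSection_matrixSection_iff :
    IsBoundedSection (matrixSection X) ↔ ∀ i j, IsBoundedSection (X i j) := by
  refine ⟨fun ⟨C, hC⟩ i j => ⟨C, fun P => (norm_le_norm_matrixSection X P i j).trans (hC P)⟩,
    fun h => ?_⟩
  choose C hC using h
  exact ⟨∑ i, ∑ j, C i j, fun P => (norm_matrixSection_le_sum X P).trans
    (Finset.sum_le_sum fun i _ => Finset.sum_le_sum fun j _ => hC i j P)⟩

theorem isContinuousSection_iff_exists_matrix {Y : ∀ P, amplifiedBundle m d n P} :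
    IsContinuousSection Unit (amplifiedBundle m d n) Y ↔
      ∃ X : Matrix (Fin m) (Fin m) (∀ P, multiplierBundle d n P),
        (∀ i j, IsContinuousSection Unit (multiplierBundle d n) (X i j)) ∧
        Y = matrixSection X := by
  constructor
  · intro hY
    obtain ⟨X, rfl⟩ := exists_eq_matrixSection Y
    exact ⟨X, isContinuousSection_matrixSection_iff.1 hY, rfl⟩
  · rintro ⟨X, hX, rfl⟩
    exact isContinuousSection_matrixSection_iff.2 hX

end MatrixSection

section BoundedMultiplierSections

theorem mem_of_forall_exists_norm_sub_le {G : Type*} [NormedAddCommGroup G] [NormedSpace ℂ G]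
    {U : Submodule ℂ G} [FiniteDimensional ℂ U] {v : G} (hv : ∀ ε > 0, ∃ u ∈ U, ‖u - v‖ ≤ ε) :
    v ∈ U := by
  refine U.closed_of_finiteDimensional.closure_subset (Metric.mem_closure_iff.2 fun ε hε => ?_)
  obtain ⟨u, hu, huv⟩ := hv (ε / 2) (half_pos hε)
  refine ⟨u, hu, ?_⟩
  rw [dist_eq_norm']
  exact huv.trans_lt (half_lt_self hε)

variable {d n m : ℕ}

/-- The algebra `Γ_b` of bounded continuous sections of `𝔐_{d,n}`. -/
noncomputable def boundedMultiplierSections (d n : ℕ) :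
    Subalgebra ℂ (∀ P, multiplierBundle d n P) :=
  have hone : multiplierSection n 1 = 1 := map_one (multiplierSectionHom d n)
  boundedSections (isBanachAlgebraBundle_multiplierBundle d n)
    (hone ▸ isContinuousSection_multiplierSection 1) (hone ▸ isBoundedSection_multiplierSection 1)

theorem isContinuousSection_and_isBoundedSection_iff_exists_matrix
    {Y : ∀ P, amplifiedBundle m d n P} :
    (IsContinuousSection Unit (amplifiedBundle m d n) Y ∧ IsBoundedSection Y) ↔
      ∃ X : Matrix (Fin m) (Fin m) (boundedMultiplierSections d n),
        Y = matrixSection (X.map Subtype.val) := by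
  constructor
  · rintro ⟨hc, hb⟩
    obtain ⟨X, rfl⟩ := exists_eq_matrixSection Y
    exact ⟨Matrix.of fun i j => ⟨X i j, isContinuousSection_matrixSection_iff.1 hc i j,
      isBoundedSection_matrixSection_iff.1 hb i j⟩, rfl⟩
  · rintro ⟨X, rfl⟩
    exact ⟨isContinuousSection_matrixSection_iff.2 fun i j => (X i j).2.1,
      isBoundedSection_matrixSection_iff.2 fun i j => (X i j).2.2⟩

/-- The bounded continuous sections of `𝔐_{d,n}` as families of operators on the spaces
`P H²_d`. -/
noncomputable def sectionOperators (d n : ℕ) : boundedMultiplierSections d n →ₐ[ℂ]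
    ∀ P : coinvariantGrassmannian d n, TautologicalFibre P →L[ℂ] TautologicalFibre P :=
  (AlgHom.pi fun P => (MultiplierFibre.toOperator P).comp (Pi.evalAlgHom ℂ _ P)).comp
    (boundedMultiplierSections d n).val

theorem isBoundedSection_sectionOperators (s : boundedMultiplierSections d n) :
    IsBoundedSection (sectionOperators d n s) := s.2.2

theorem sectionOperators_injective : Function.Injective (sectionOperators d n) := fun _ _ h =>
  Subtype.ext <| funext fun P => MultiplierFibre.toOperator_injective P (congrFun h P)

/-- The fibres of `𝔐_{d,n}` are closed in the operators on `P H²_d`, being finite-dimensional. -/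
theorem mem_range_sectionOperators_of_uniform_limit
    {T : ∀ P : coinvariantGrassmannian d n, TautologicalFibre P →L[ℂ] TautologicalFibre P}
    (hT : ∀ ε > 0, ∃ s, ∀ P, ‖sectionOperators d n s P - T P‖ ≤ ε) :
    T ∈ Set.range (sectionOperators d n) := by
  have hmem : ∀ P, T P ∈ (MultiplierFibre.toOperator P).toLinearMap.range := by
    refine fun P => mem_of_forall_exists_norm_sub_le
      (G := TautologicalFibre P →L[ℂ] TautologicalFibre P) fun ε hε => ?_
    obtain ⟨s, hs⟩ := hT ε hε
    exact ⟨_, LinearMap.mem_range_self (MultiplierFibre.toOperator P).toLinearMap (s.1 P), hs P⟩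
  choose t ht using hmem
  obtain rfl : (fun P => MultiplierFibre.toOperator P (t P)) = T := funext ht
  have hnorm : ∀ ε > 0, ∃ s ∈ boundedMultiplierSections d n, ∀ P, ‖s P - t P‖ ≤ ε := fun ε hε => by
    obtain ⟨s, hs⟩ := hT ε hε
    exact ⟨s.1, s.2, hs⟩
  refine ⟨⟨t, ?_, ?_⟩, rfl⟩
  · refine (isBanachAlgebraBundle_multiplierBundle d n).isContinuousSection_of_uniform_limit
      (isFellFamily_multiplierSectionHom d n).exists_isContinuousSection_eq fun ε hε => ?_
    obtain ⟨s, hs, hst⟩ := hnorm ε hε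
    exact ⟨s, hs.1, hst⟩
  · obtain ⟨s, ⟨-, C, hC⟩, hst⟩ := hnorm 1 one_pos
    refine ⟨C + 1, fun P => ?_⟩
    linarith [norm_sub_norm_le (t P) (s P), norm_sub_rev (t P) (s P), hC P, hst P]

/-- The representation of `Γ_b` by diagonal operators on the Hilbert sum of the spaces `P H²_d`. -/
noncomputable def sectionRepresentation (d n : ℕ) : boundedMultiplierSections d n →ₐ[ℂ]
    (lp (tautologicalBundle d n) 2 →L[ℂ] lp (tautologicalBundle d n) 2) :=
  diagonalRepresentation (sectionOperators d n) isBoundedSection_sectionOperators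

theorem norm_matrixOperator_sectionRepresentation
    (X : Matrix (Fin m) (Fin m) (boundedMultiplierSections d n)) :
    ‖matrixOperator m (lp (tautologicalBundle d n) 2) (X.map (sectionRepresentation d n))‖ =
      supMatrixNorm (X.map Subtype.val) :=
  norm_matrixOperator_diagonalOperator fun i j => isBoundedSection_sectionOperators (X i j)

theorem sectionRepresentation_injective : Function.Injective (sectionRepresentation d n) :=
  diagonalRepresentation_injective _ sectionOperators_injective

theorem isClosed_range_sectionRepresentation (d n : ℕ) :
    IsClosed (Set.range (sectionRepresentation d n)) :=
  isClosed_range_diagonalRepresentation _ fun _ => mem_range_sectionOperators_of_uniform_limit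

theorem nontrivial_lp_tautologicalBundle (hd : 0 < d) (hn : 0 < n) :
    Nontrivial (lp (tautologicalBundle d n) 2) := by
  classical
  obtain ⟨P⟩ := nonempty_coinvariantGrassmannian hd n
  have : Nontrivial (tautologicalBundle d n P) :=
    Module.nontrivial_of_finrank_pos (R := ℂ) (by rwa [finrank_tautologicalFibre])
  exact (lp.isometry_single (E := tautologicalBundle d n) (p := 2) P).injective.nontrivial

theorem isRepresentedOperatorAlgebra_boundedMultiplierSections (d n : ℕ) :
    IsRepresentedOperatorAlgebra (boundedMultiplierSections d n)
      fun _ X => supMatrixNorm (X.map Subtype.val) :=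
  have : ∀ P, CompleteSpace (tautologicalBundle d n P) := fun _ => FiniteDimensional.complete ℂ _
  ⟨_, _, _, lp.completeSpace, sectionRepresentation d n,
    isClosed_range_sectionRepresentation d n, fun _ => norm_matrixOperator_sectionRepresentation⟩

theorem isAbstractOperatorAlgebra_boundedMultiplierSections (hd : 0 < d) (hn : 0 < n) :
    IsAbstractOperatorAlgebra (boundedMultiplierSections d n)
      fun _ X => supMatrixNorm (X.map Subtype.val) := by
  have : ∀ P, CompleteSpace (tautologicalBundle d n P) := fun _ => FiniteDimensional.complete ℂ _
  have : Nontrivial (lp (tautologicalBundle d n) 2) := nontrivial_lp_tautologicalBundle hd hn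
  simpa only [norm_matrixOperator_sectionRepresentation] using
    IsAbstractOperatorAlgebra.of_representation sectionRepresentation_injective
      (isClosed_range_sectionRepresentation d n)

end BoundedMultiplierSections

end

open Bundle in
theorem proposition5p1 (d n : ℕ) (hd : 0 < d) (hn : 0 < n) :
    -- the tautological bundle is a Hilbert bundle of rank `n`
    IsHilbertBundle (EuclideanSpace ℂ (Fin n)) (tautologicalBundle d n) ∧
    -- the compressed multipliers form a Banach algebra bundle, whose topology is the only one
    -- making it a Banach bundle with all the sections `γ_f` continuous
    (IsBanachAlgebraBundle Unit (multiplierBundle d n) ∧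
      (∀ f, IsContinuousSection Unit (multiplierBundle d n) (multiplierSection n f)) ∧
      ∀ τ : TopologicalSpace (TotalSpace Unit (multiplierBundle d n)),
        @IsBanachBundle _ _ Unit (multiplierBundle d n) _ _ τ →
        (∀ f, @IsContinuousSection _ _ Unit (multiplierBundle d n) τ (multiplierSection n f)) →
        τ = multiplierTopology d n) ∧
    -- the same for all matrix amplifications
    (∀ m : ℕ, IsBanachAlgebraBundle Unit (amplifiedBundle m d n) ∧
      (∀ f, IsContinuousSection Unit (amplifiedBundle m d n) (amplifiedMultiplierSection n f)) ∧
      ∀ τ : TopologicalSpace (TotalSpace Unit (amplifiedBundle m d n)),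
        @IsBanachBundle _ _ Unit (amplifiedBundle m d n) _ _ τ →
        (∀ f, @IsContinuousSection _ _ Unit (amplifiedBundle m d n) τ
          (amplifiedMultiplierSection n f)) →
        τ = amplifiedTopology m d n) ∧
    -- the continuous sections of the amplifications are the matrices of continuous sections
    (∀ (m : ℕ) (Y : ∀ P, amplifiedBundle m d n P),
      IsContinuousSection Unit (amplifiedBundle m d n) Y ↔
        ∃ X : Matrix (Fin m) (Fin m) (∀ P, multiplierBundle d n P),
          (∀ i j, IsContinuousSection Unit (multiplierBundle d n) (X i j)) ∧
          Y = matrixSection X) ∧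
    -- the bounded continuous sections form an operator algebra
    ∃ Γb : Subalgebra ℂ (∀ P, multiplierBundle d n P),
      (∀ x, x ∈ Γb ↔ IsContinuousSection Unit (multiplierBundle d n) x ∧ IsBoundedSection x) ∧
      (∀ f, multiplierSection n f ∈ Γb) ∧
      -- `M_m(Γb)` consists of the bounded continuous sections of the `m`-th amplification
      (∀ (m : ℕ) (Y : ∀ P, amplifiedBundle m d n P),
        (IsContinuousSection Unit (amplifiedBundle m d n) Y ∧ IsBoundedSection Y) ↔
          ∃ X : Matrix (Fin m) (Fin m) Γb, Y = matrixSection (X.map Subtype.val)) ∧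
      -- at the first level the norm is the supremum norm of sections
      (∀ x : Γb, supMatrixNorm (Matrix.of fun _ _ : Fin 1 => x.1) = ⨆ P, ‖x.1 P‖) ∧
      IsAbstractOperatorAlgebra Γb (fun m X => supMatrixNorm (m := m) (X.map Subtype.val)) ∧
      IsRepresentedOperatorAlgebra Γb (fun m X => supMatrixNorm (m := m) (X.map Subtype.val)) :=
    by
  exact ⟨isHilbertBundle_tautologicalBundle,
    ⟨isBanachAlgebraBundle_multiplierBundle d n, isContinuousSection_multiplierSection,
      fun τ hτ hγ => (isFellFamily_multiplierSectionHom d n).eq_of_isBanachBundle hτ hγ⟩,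
    fun m => ⟨isBanachAlgebraBundle_amplifiedBundle m d n,
      isContinuousSection_amplifiedMultiplierSection,
      fun τ hτ hγ =>
        (isFellFamily_amplifiedMultiplierSectionHom m d n).eq_of_isBanachBundle hτ hγ⟩,
    fun m Y => isContinuousSection_iff_exists_matrix,
    boundedMultiplierSections d n, fun s => Iff.rfl,
    fun f => ⟨isContinuousSection_multiplierSection f, isBoundedSection_multiplierSection f⟩,
    fun m Y => isContinuousSection_and_isBoundedSection_iff_exists_matrix,
    fun s => iSup_congr (norm_matrixSection_one s.1),
    isAbstractOperatorAlgebra_boundedMultiplierSections hd hn,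
    isRepresentedOperatorAlgebra_boundedMultiplierSections d n⟩
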